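/- Let $P=\{x\in\mathbb{R}^n : Ax\le b\}$ be a bounded polyhedron given by a matrix $A=[a_1,\dots,a_m]^{\mathrm T}\in\mathbb{R}^{m\times n}$ with $\|a_i\|=1$ for all $i$ and a vector $b\in\mathbb{R}^m$, and assume that $P$ is non-degenerate, i.e. exactly $n$ constraints are tight at every vertex of $P$. Let $\delta>0$ be such that $A$ has the $\delta$-distance property: for every set $I$ of row indices and every row $a_j\notin\mathrm{span}\{a_i : i\in I\}$, the Euclidean distance of $a_j$ from $\mathrm{span}\{a_i : i\in I\}$ is at least $\delta$. Let $c_0\in\mathbb{R}^n$ with $\|c_0\|=1$, let $\phi\ge\sqrt n$, and let $x_0$ be a basic feasible solution of $P$ with linearly independent rows $u_1,\dots,u_n$ of $A$ that are tight at $x_0$. Draw $c\in\mathbb{R}^n$ by choosing each coordinate $c_i$ independently and uniformly at random from an arbitrary interval $I_i\subseteq[-1,1]$ of length $1/\phi$ containing $(c_0)_i$, and, independently of $c$, draw $\lambda\in(0,1]^n$ uniformly at random and set $w=-\sum_{k=1}^n\lambda_k u_k$. Let $\pi(x)=(c^{\mathrm T}x,w^{\mathrm T}x)$. The path computed by one run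 of the shadow vertex algorithm is the path from $\pi(x_0)$ to the rightmost vertex along the edges of the lower envelope of the polygon $\pi(P)$, in increasing direction of the first coordinate. Then the expected number of edges of this path is at most $$\frac{4mn^2}{\delta^2}+\frac{2m\sqrt n\,\phi}{\delta},$$ and hence $O\!\left(\frac{mn^2}{\delta^2}+\frac{m\sqrt n\,\phi}{\delta}\right)$ with an absolute constant. -/

import Mathlib

open MeasureTheory ProbabilityTheory
open scoped ENNReal

namespace ShadowVertex

noncomputable section

/-- The polyhedron `{x ∈ ℝⁿ | A x ≤ b}`, where `a i` is the `i`-th row of `A`. -/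
def polyhedron {n m : ℕ} (a : Fin m → EuclideanSpace ℝ (Fin n)) (b : Fin m → ℝ) :
    Set (EuclideanSpace ℝ (Fin n)) :=
  {x | ∀ i, inner ℝ (a i) x ≤ b i}

/-- The `δ`-distance property: a row that does not lie in the span of some set of rows has
Euclidean distance at least `δ` from this span. -/
def DeltaDistanceProperty {n m : ℕ} (a : Fin m → EuclideanSpace ℝ (Fin n)) (δ : ℝ) : Prop :=
  ∀ (I : Set (Fin m)) (j : Fin m), a j ∉ Submodule.span ℝ (a '' I) →
    δ ≤ Metric.infDist (a j) (Submodule.span ℝ (a '' I) : Set (EuclideanSpace ℝ (Fin n)))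

/-- Non-degeneracy: at every vertex of the polyhedron exactly `n` constraints are tight. -/
def Nondegenerate {n m : ℕ} (a : Fin m → EuclideanSpace ℝ (Fin n)) (b : Fin m → ℝ) : Prop :=
  ∀ x ∈ (polyhedron a b).extremePoints ℝ, {i : Fin m | inner ℝ (a i) x = b i}.ncard = n

/-- The law of the perturbed objective: the coordinates are independent, the `i`-th one is uniformly
distributed on the interval `[l i, l i + 1 / φ]`. -/
def perturbationLaw {n : ℕ} (l : Fin n → ℝ) (φ : ℝ) : Measure (Fin n → ℝ) :=
  Measure.pi fun i => (volume : Measure ℝ)[|Set.Icc (l i) (l i + 1 / φ)]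

/-- The uniform distribution on `(0, 1]ⁿ`. -/
def coefficientLaw (n : ℕ) : Measure (Fin n → ℝ) :=
  Measure.pi fun _ => (volume : Measure ℝ)[|Set.Ioc (0 : ℝ) 1]

/-- The starting objective `w = -[u₁, …, uₙ] · lam`. -/
def startObjective {n : ℕ} (u : Fin n → EuclideanSpace ℝ (Fin n)) (lam : Fin n → ℝ) :
    EuclideanSpace ℝ (Fin n) :=
  -∑ k, lam k • u k

/-- The projection `π : x ↦ (cᵀ x, wᵀ x)` onto the plane. -/
def proj {n : ℕ} (c w x : EuclideanSpace ℝ (Fin n)) : ℝ × ℝ :=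
  (inner ℝ c x, inner ℝ w x)

/-- The shadow vertex polygon `P' = π(P)`. -/
def shadow {n : ℕ} (P : Set (EuclideanSpace ℝ (Fin n))) (c w : EuclideanSpace ℝ (Fin n)) :
    Set (ℝ × ℝ) :=
  proj c w '' P

/-- The lower envelope of a planar set: its points with no point of the set vertically below. -/
def lowerEnvelope (Q : Set (ℝ × ℝ)) : Set (ℝ × ℝ) :=
  {p ∈ Q | ∀ q ∈ Q, q.1 = p.1 → p.2 ≤ q.2}

/-- `e` is an edge of the convex polygon `Q`: a nondegenerate segment that is a face of `Q`. -/
def IsEdge (Q e : Set (ℝ × ℝ)) : Prop :=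
  (∃ p q : ℝ × ℝ, p ≠ q ∧ e = segment ℝ p q) ∧ IsExtreme ℝ Q e

/-- The path of the shadow vertex algorithm: the part of the lower envelope of the shadow vertex
polygon that starts at `π(x₀)` and runs in increasing direction of the first coordinate to the
rightmost vertex of the lower envelope. -/
def shadowPath {n : ℕ} (P : Set (EuclideanSpace ℝ (Fin n))) (x₀ c w : EuclideanSpace ℝ (Fin n)) :
    Set (ℝ × ℝ) :=
  {p ∈ lowerEnvelope (shadow P c w) | (proj c w x₀).1 ≤ p.1}

/-- The edges on the path: the edges of the shadow vertex polygon that lie on the path. -/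
def pathEdges {n : ℕ} (P : Set (EuclideanSpace ℝ (Fin n))) (x₀ c w : EuclideanSpace ℝ (Fin n)) :
    Set (Set (ℝ × ℝ)) :=
  {e | IsEdge (shadow P c w) e ∧ e ⊆ shadowPath P x₀ c w}

/-- The number of edges on the path, as an extended nonnegative real, when the shadow vertex
algorithm is run from `x₀` with the tight rows `u`, and draws the objective `ω.1` and the
coefficients `ω.2`. -/
def numPathEdges {n : ℕ} (P : Set (EuclideanSpace ℝ (Fin n))) (x₀ : EuclideanSpace ℝ (Fin n))
    (u : Fin n → EuclideanSpace ℝ (Fin n)) (ω : (Fin n → ℝ) × (Fin n → ℝ)) : ℝ≥0∞ :=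
  ((pathEdges P x₀ (WithLp.toLp 2 ω.1) (startObjective u ω.2)).encard : ℝ≥0∞)

end

end ShadowVertex

/-! Put `v = -w`, a combination of the starting rows with coefficients in `(0, 1]`. An edge of the
lower envelope is cut out by a supporting line of some slope `s`, that is, it is the image of the
face of `P` on which `v + s • c` is maximal. Since `x₀` is the unique minimizer of `w`, the edges to
the right of `π(x₀)` are those with `s > 0`. So `encard_pathEdges` turns the path length into the
number of positive breakpoints of `s ↦ max ⟪v + s • c, x⟫`. The ray is cut at `s = n`; beyond it,
dividing by `s` turns breakpoints into those of `c + t • v` with `t ≤ 1 / n`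
(`encard_breaks_Ioi_le`).

At a breakpoint the objective lies on a wall of the normal fan. Walls are described facet by facet:
maximize `y` over the facet `k`, expand `y` in the rows tight at an optimal vertex, and read off the
coefficient of `a k`. This number does not depend on the optimal vertex (`FacetMax.inner_pivot_le`),
grows by exactly `r` when `y` becomes `y + r • a k`, and is `0` for some `k` whenever the maximizer
over `P` is not unique (`eventually_exists_inner_pivot_eq_zero`). The distance property bounds its
rate of change along a direction `q` by `‖q‖ / δ`.

Hence `coefficient > -η` is carried into `coefficient ≥ η` by the translation `2 * η • a k`. A
uniform law on a box nearly preserves probabilities under small translations, so the slab between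
has probability `O(η)` (`pi_cond_wallSet_le`). Charging each breakpoint to a nearby grid point in
such a slab, summing probabilities and refining the grid with Fatou's lemma gives `2 * m * L * T *
D` (`lintegral_encard_breaks_le`). For `s ≤ n` the coefficients `λ` supply the randomness with `c`
fixed, and for `s > n` it is `c` with `λ` fixed; the two bounds are the two terms of the claim. -/

namespace ShadowVertex

open Filter Topology

/-! ### Vertices, facet maxima and walls of the normal fan. -/

section Polytope

variable {n m : ℕ} {a : Fin m → EuclideanSpace ℝ (Fin n)} {b : Fin m → ℝ}

/-- The face of `P` on which the linear functional `⟪y, ·⟫` is maximal. -/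
def maxFace {n : ℕ} (P : Set (EuclideanSpace ℝ (Fin n))) (y : EuclideanSpace ℝ (Fin n)) :
    Set (EuclideanSpace ℝ (Fin n)) :=
  {x ∈ P | ∀ z ∈ P, inner ℝ y z ≤ inner ℝ y x}

theorem isExposed_maxFace (P : Set (EuclideanSpace ℝ (Fin n))) (y : EuclideanSpace ℝ (Fin n)) :
    IsExposed ℝ P (maxFace P y) :=
  fun _ => ⟨innerSL ℝ y, rfl⟩

theorem isExtreme_maxFace (P : Set (EuclideanSpace ℝ (Fin n))) (y : EuclideanSpace ℝ (Fin n)) :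
    IsExtreme ℝ P (maxFace P y) :=
  (isExposed_maxFace P y).isExtreme

theorem IsCompact.maxFace {P : Set (EuclideanSpace ℝ (Fin n))} (hP : IsCompact P)
    (y : EuclideanSpace ℝ (Fin n)) : IsCompact (maxFace P y) :=
  (isExposed_maxFace P y).isCompact hP

theorem nonempty_maxFace {P : Set (EuclideanSpace ℝ (Fin n))} (hP : IsCompact P)
    (hne : P.Nonempty) (y : EuclideanSpace ℝ (Fin n)) : (maxFace P y).Nonempty := by
  obtain ⟨x, hx, hmax⟩ := hP.exists_isMaxOn hne
    (f := fun z => inner ℝ y z) (by fun_prop)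
  exact ⟨x, hx, fun z hz => hmax hz⟩

theorem exists_extremePoint_mem_maxFace {P : Set (EuclideanSpace ℝ (Fin n))} (hP : IsCompact P)
    (hne : P.Nonempty) (y : EuclideanSpace ℝ (Fin n)) :
    ∃ x ∈ P.extremePoints ℝ, x ∈ maxFace P y := by
  obtain ⟨x, hx⟩ := (IsCompact.maxFace hP y).extremePoints_nonempty (nonempty_maxFace hP hne y)
  exact ⟨x, (isExtreme_maxFace P y).extremePoints_subset_extremePoints hx, hx.1⟩

theorem isClosed_polyhedron (a : Fin m → EuclideanSpace ℝ (Fin n)) (b : Fin m → ℝ) :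
    IsClosed (polyhedron a b) := by
  have : polyhedron a b = ⋂ i, {x | inner ℝ (a i) x ≤ b i} := by
    ext x; simp [polyhedron]
  rw [this]
  exact isClosed_iInter fun i => isClosed_le (by fun_prop) (by fun_prop)

theorem isCompact_polyhedron (h : Bornology.IsBounded (polyhedron a b)) :
    IsCompact (polyhedron a b) :=
  Metric.isCompact_of_isClosed_isBounded (isClosed_polyhedron a b) h

theorem convex_polyhedron (a : Fin m → EuclideanSpace ℝ (Fin n)) (b : Fin m → ℝ) :
    Convex ℝ (polyhedron a b) := by
  intro x hx z hz s t hs ht hst i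
  rw [inner_add_right, real_inner_smul_right, real_inner_smul_right]
  have h1 := mul_le_mul_of_nonneg_left (hx i) hs
  have h2 := mul_le_mul_of_nonneg_left (hz i) ht
  have h3 : s * b i + t * b i = b i := by rw [← add_mul, hst, one_mul]
  linarith

/-- A direction that does not increase any tight constraint is feasible. -/
theorem eventually_add_smul_mem_polyhedron {x e : EuclideanSpace ℝ (Fin n)}
    (hx : x ∈ polyhedron a b) (he : ∀ i, inner ℝ (a i) x = b i → inner ℝ (a i) e ≤ 0) :
    ∀ᶠ θ : ℝ in 𝓝[>] 0, x + θ • e ∈ polyhedron a b := by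
  refine eventually_all.2 fun i => ?_
  rcases (hx i).lt_or_eq with hi | hi
  · have hc : Tendsto (fun θ : ℝ => inner ℝ (a i) (x + θ • e)) (𝓝[>] 0) (𝓝 (inner ℝ (a i) x)) := by
      have : Continuous fun θ : ℝ => inner ℝ (a i) (x + θ • e) := by fun_prop
      have h := this.tendsto 0
      rw [zero_smul, add_zero] at h
      exact h.mono_left nhdsWithin_le_nhds
    exact (hc.eventually (gt_mem_nhds hi)).mono fun θ h => h.le
  · filter_upwards [self_mem_nhdsWithin] with θ hθ
    rw [inner_add_right, real_inner_smul_right, hi]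
    have := mul_nonpos_of_nonneg_of_nonpos (le_of_lt (Set.mem_Ioi.1 hθ)) (he i hi)
    linarith

theorem inner_eq_zero_of_mem_span {S : Set (EuclideanSpace ℝ (Fin n))}
    {e u : EuclideanSpace ℝ (Fin n)} (h : ∀ z ∈ S, inner ℝ z e = 0)
    (hu : u ∈ Submodule.span ℝ S) : inner ℝ u e = 0 := by
  induction hu using Submodule.span_induction with
  | mem u hu => exact h u hu
  | zero => simp
  | add u v _ _ hu hv => rw [inner_add_left, hu, hv, add_zero]
  | smul t u _ hu => rw [real_inner_smul_left, hu, mul_zero]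

theorem eq_zero_of_span_eq_top {S : Set (EuclideanSpace ℝ (Fin n))}
    (hS : Submodule.span ℝ S = ⊤) {e : EuclideanSpace ℝ (Fin n)}
    (h : ∀ z ∈ S, inner ℝ z e = 0) : e = 0 :=
  inner_self_eq_zero.1 (inner_eq_zero_of_mem_span h (hS ▸ Submodule.mem_top))

/-- A direction orthogonal to all tight rows could be followed both ways from `x`, making `x` a
midpoint of two points of the polyhedron. -/
theorem span_tight_eq_top {x : EuclideanSpace ℝ (Fin n)}
    (hx : x ∈ (polyhedron a b).extremePoints ℝ) :
    Submodule.span ℝ (Set.range fun i : {i // inner ℝ (a i) x = b i} => a i) = ⊤ := by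
  rw [← Submodule.orthogonal_eq_bot_iff, Submodule.eq_bot_iff]
  intro e he
  have h0 : ∀ i, inner ℝ (a i) x = b i → inner ℝ (a i) e = 0 := fun i hi =>
    (Submodule.mem_orthogonal _ _).1 he _ (Submodule.subset_span ⟨⟨i, hi⟩, rfl⟩)
  have h1 := eventually_add_smul_mem_polyhedron hx.1 (e := e) fun i hi => (h0 i hi).le
  have h2 := eventually_add_smul_mem_polyhedron hx.1 (e := -e) fun i hi => by
    rw [inner_neg_right, h0 i hi, neg_zero]
  obtain ⟨θ, ⟨h1, h2⟩, hθ⟩ := ((h1.and h2).and self_mem_nhdsWithin).exists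
  have := hx.2 h1 h2 ⟨1 / 2, 1 / 2, by norm_num, by norm_num, by norm_num, by module⟩
  have hθ' : θ ≠ 0 := ne_of_gt hθ
  have h3 : θ • e = 0 := by simpa using this
  exact (smul_eq_zero.1 h3).resolve_left hθ'

/-- The tight rows span, and non-degeneracy says there are exactly `n` of them. -/
theorem linearIndependent_tight (hnd : Nondegenerate a b) {x : EuclideanSpace ℝ (Fin n)}
    (hx : x ∈ (polyhedron a b).extremePoints ℝ) :
    LinearIndependent ℝ fun i : {i // inner ℝ (a i) x = b i} => a i := by
  classical
  refine linearIndependent_of_top_le_span_of_card_eq_finrank (span_tight_eq_top hx).ge ?_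
  have h := hnd x hx
  rw [finrank_euclideanSpace_fin, ← Nat.card_eq_fintype_card]
  exact h

theorem eq_of_tight {x z : EuclideanSpace ℝ (Fin n)} (hx : x ∈ (polyhedron a b).extremePoints ℝ)
    (h : ∀ i, inner ℝ (a i) x = b i → inner ℝ (a i) z = b i) : z = x := by
  refine sub_eq_zero.1 (eq_zero_of_span_eq_top (span_tight_eq_top hx) ?_)
  rintro _ ⟨i, rfl⟩
  simp only
  rw [inner_sub_right, h i i.2, i.2, sub_self]

theorem finite_extremePoints_polyhedron (a : Fin m → EuclideanSpace ℝ (Fin n)) (b : Fin m → ℝ) :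
    ((polyhedron a b).extremePoints ℝ).Finite := by
  refine Set.Finite.of_finite_image (f := fun x => {i | inner ℝ (a i) x = b i})
    (Set.toFinite _) ?_
  intro x hx z _ hxz
  refine (eq_of_tight hx fun i hi => ?_).symm
  exact (Set.ext_iff.1 hxz i).1 hi

/-- `e` is dual to the row `a k` in the basis of rows that are tight at `x`. The vector `-e` is
the direction of the edge that leaves the facet `k` at the vertex `x`. -/
def IsPivot (a : Fin m → EuclideanSpace ℝ (Fin n)) (b : Fin m → ℝ) (k : Fin m)
    (x e : EuclideanSpace ℝ (Fin n)) : Prop :=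
  inner ℝ (a k) e = 1 ∧ ∀ i, inner ℝ (a i) x = b i → i ≠ k → inner ℝ (a i) e = 0

theorem exists_isPivot (hnd : Nondegenerate a b) {x : EuclideanSpace ℝ (Fin n)}
    (hx : x ∈ (polyhedron a b).extremePoints ℝ) {k : Fin m} (hk : inner ℝ (a k) x = b k) :
    ∃ e, IsPivot a b k x e := by
  let β := Module.Basis.mk (linearIndependent_tight hnd hx) (span_tight_eq_top hx).ge
  -- The Riesz representative of the coordinate functional of the row `k`.
  let e := (InnerProductSpace.toDual ℝ (EuclideanSpace ℝ (Fin n))).symm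
    (LinearMap.toContinuousLinearMap (β.coord ⟨k, hk⟩))
  have he : ∀ i (hi : inner ℝ (a i) x = b i), inner ℝ (a i) e = β.coord ⟨k, hk⟩ (β ⟨i, hi⟩) := by
    intro i hi
    rw [real_inner_comm, InnerProductSpace.toDual_symm_apply, Module.Basis.mk_apply]
    rfl
  refine ⟨e, ?_, fun i hi hik => ?_⟩
  · rw [he k hk]; simp
  · rw [he i hi, Module.Basis.coord_apply, Module.Basis.repr_self, Finsupp.single_apply, if_neg]
    simpa using hik

theorem exists_isPivot_family (hnd : Nondegenerate a b) {k : Fin m}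
    {x e : EuclideanSpace ℝ (Fin n)} (hx : x ∈ (polyhedron a b).extremePoints ℝ)
    (hk : inner ℝ (a k) x = b k) (he : IsPivot a b k x e) :
    ∃ g : {i // inner ℝ (a i) x = b i} → EuclideanSpace ℝ (Fin n),
      g ⟨k, hk⟩ = e ∧ ∀ i, IsPivot a b i.1 x (g i) := by
  classical
  choose f hf using fun i : {i // inner ℝ (a i) x = b i} => exists_isPivot hnd hx i.2
  refine ⟨Function.update f ⟨k, hk⟩ e, Function.update_self _ _ _, fun i => ?_⟩
  by_cases hi : i = ⟨k, hk⟩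
  · subst hi; rw [Function.update_self]; exact he
  · rw [Function.update_of_ne hi]; exact hf i

/-- Moving a little from a vertex along an edge stays in the polyhedron. -/
theorem IsPivot.exists_add_smul_neg_mem {k : Fin m} {x e : EuclideanSpace ℝ (Fin n)}
    (he : IsPivot a b k x e) (hx : x ∈ polyhedron a b) :
    ∃ θ : ℝ, 0 < θ ∧ x + θ • -e ∈ polyhedron a b := by
  have hev := eventually_add_smul_mem_polyhedron (e := -e) hx fun j hj => by
    rw [inner_neg_right]
    by_cases hjk : j = k
    · rw [hjk, he.1]; norm_num
    · rw [he.2 j hj hjk, neg_zero]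
  obtain ⟨θ, hθ, hθ0⟩ := (hev.and self_mem_nhdsWithin).exists
  exact ⟨θ, hθ0, hθ⟩

open Classical in
/-- The expansion of `y` in the basis of the tight rows. -/
theorem sum_pivot_smul (hnd : Nondegenerate a b) {x : EuclideanSpace ℝ (Fin n)}
    (hx : x ∈ (polyhedron a b).extremePoints ℝ)
    {e : {i // inner ℝ (a i) x = b i} → EuclideanSpace ℝ (Fin n)}
    (he : ∀ i, IsPivot a b i.1 x (e i)) (y : EuclideanSpace ℝ (Fin n)) :
    ∑ i, (inner ℝ (e i) y : ℝ) • a i.1 = y := by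
  let β := Module.Basis.mk (linearIndependent_tight hnd hx) (span_tight_eq_top hx).ge
  have hβ : ∀ i, β i = a i.1 := fun i => by simp [β]
  have h1 : ∀ i, inner ℝ (e i) y = β.repr y i := by
    intro i
    conv_lhs => rw [← β.sum_repr y, inner_sum]
    rw [Finset.sum_eq_single i]
    · rw [real_inner_smul_right, hβ, real_inner_comm, (he i).1, mul_one]
    · intro j _ hj
      rw [real_inner_smul_right, hβ, real_inner_comm, (he i).2 j j.2 fun h => hj (Subtype.ext h),
        mul_zero]
    · simp
  conv_rhs => rw [← β.sum_repr y]
  simp only [h1, hβ]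

/-- `x` maximizes `⟪y, ·⟫` over the facet `k`. -/
def FacetMax (a : Fin m → EuclideanSpace ℝ (Fin n)) (b : Fin m → ℝ) (k : Fin m)
    (y x : EuclideanSpace ℝ (Fin n)) : Prop :=
  x ∈ polyhedron a b ∧ inner ℝ (a k) x = b k ∧
    ∀ z ∈ polyhedron a b, inner ℝ (a k) z = b k → inner ℝ y z ≤ inner ℝ y x

theorem exists_facetMax (hP : IsCompact (polyhedron a b)) {k : Fin m}
    {x : EuclideanSpace ℝ (Fin n)} (hx : x ∈ polyhedron a b) (hk : inner ℝ (a k) x = b k)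
    (y : EuclideanSpace ℝ (Fin n)) :
    ∃ z ∈ (polyhedron a b).extremePoints ℝ, FacetMax a b k y z := by
  have hF : x ∈ maxFace (polyhedron a b) (a k) := ⟨hx, fun z hz => hk ▸ hz k⟩
  obtain ⟨z, hz, hmax⟩ := exists_extremePoint_mem_maxFace (IsCompact.maxFace hP (a k)) ⟨x, hF⟩ y
  refine ⟨z, (isExtreme_maxFace _ _).extremePoints_subset_extremePoints hz, hmax.1.1,
    le_antisymm (hmax.1.1 k) (hk ▸ hmax.1.2 x hx), fun w hw hwk => hmax.2 w ⟨hw, fun v hv => ?_⟩⟩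
  rw [hwk]
  exact hv k

theorem FacetMax.add_smul {k : Fin m} {y x : EuclideanSpace ℝ (Fin n)} (h : FacetMax a b k y x)
    (r : ℝ) : FacetMax a b k (y + r • a k) x := by
  refine ⟨h.1, h.2.1, fun z hz hzk => ?_⟩
  have := h.2.2 z hz hzk
  simp only [inner_add_left, real_inner_smul_left, hzk, h.2.1]
  linarith

/-- Closedness serves twice: for measurability of the walls, and to see that vertices not optimal
for `y` stay non-optimal near `y`. -/
theorem isClosed_setOf_facetMax (k : Fin m) (x : EuclideanSpace ℝ (Fin n)) :
    IsClosed {y | FacetMax a b k y x} := by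
  by_cases hx : x ∈ polyhedron a b ∧ inner ℝ (a k) x = b k
  · have : {y | FacetMax a b k y x} = ⋂ z ∈ {z | z ∈ polyhedron a b ∧ inner ℝ (a k) z = b k},
        {y | inner ℝ y z ≤ inner ℝ y x} := by
      ext y
      simp only [FacetMax, Set.mem_ofPred_eq, Set.mem_iInter]
      exact ⟨fun h z hz => h.2.2 z hz.1 hz.2, fun h => ⟨hx.1, hx.2, fun z hz hzk => h z ⟨hz, hzk⟩⟩⟩
    rw [this]
    exact isClosed_biInter fun z _ => isClosed_le (by fun_prop) (by fun_prop)
  · have : {y | FacetMax a b k y x} = ∅ := by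
      ext y
      simp only [Set.mem_ofPred_eq, Set.mem_empty_iff_false, iff_false]
      exact fun h => hx ⟨h.1, h.2.1⟩
    rw [this]
    exact isClosed_empty

/-- At a facet maximum the coefficients of `y` with respect to the other tight rows are
nonnegative, so moving away from the facet has a controlled effect. -/
theorem FacetMax.inner_pivot_mul_le (hnd : Nondegenerate a b) {k : Fin m}
    {y x e z : EuclideanSpace ℝ (Fin n)} (h : FacetMax a b k y x)
    (hx : x ∈ (polyhedron a b).extremePoints ℝ) (he : IsPivot a b k x e)
    (hz : z ∈ polyhedron a b) :
    inner ℝ e y * (b k - inner ℝ (a k) z) ≤ inner ℝ y (x - z) := by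
  classical
  obtain ⟨g, hgk, hg⟩ := exists_isPivot_family hnd hx h.2.1 he
  -- The edge leaving another tight constraint `i` stays in the facet `k`, so optimality there
  -- forbids a gain along it.
  have hnn : ∀ i, i ≠ ⟨k, h.2.1⟩ → 0 ≤ inner ℝ (g i) y := by
    intro i hi
    have hik : k ≠ i.1 := fun h' => hi (Subtype.ext h'.symm)
    obtain ⟨θ, hθ0, hθ⟩ := (hg i).exists_add_smul_neg_mem hx.1
    have hkz : inner ℝ (a k) (x + θ • -g i) = b k := by
      rw [inner_add_right, real_inner_smul_right, inner_neg_right, (hg i).2 k h.2.1 hik, h.2.1]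
      ring
    have := h.2.2 _ hθ hkz
    rw [inner_add_right, real_inner_smul_right, inner_neg_right,
      real_inner_comm (g i) y] at this
    nlinarith
  have hsum := sum_pivot_smul hnd hx hg y
  have hexp : inner ℝ y (x - z) = ∑ i, inner ℝ (g i) y * (b i.1 - inner ℝ (a i.1) z) := by
    conv_lhs => rw [← hsum, sum_inner]
    refine Finset.sum_congr rfl fun i _ => ?_
    rw [real_inner_smul_left, inner_sub_right, i.2]
  rw [hexp, ← Finset.add_sum_erase _ _ (Finset.mem_univ ⟨k, h.2.1⟩), hgk]
  refine le_add_of_nonneg_right (Finset.sum_nonneg fun i hi => mul_nonneg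
    (hnn i (Finset.ne_of_mem_erase hi)) (sub_nonneg.2 (hz i)))

/-- Test the previous inequality at a point slightly off the facet on the edge leaving `x'`; both
vertices have the same objective value. Used in both directions, this makes the coefficient of `a k`
a function of `y` alone. -/
theorem FacetMax.inner_pivot_le (hnd : Nondegenerate a b) {k : Fin m}
    {y x e x' e' : EuclideanSpace ℝ (Fin n)} (h : FacetMax a b k y x)
    (hx : x ∈ (polyhedron a b).extremePoints ℝ) (he : IsPivot a b k x e)
    (h' : FacetMax a b k y x') (he' : IsPivot a b k x' e') :
    inner ℝ e y ≤ inner ℝ e' y := by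
  obtain ⟨θ, hθ0, hθ⟩ := he'.exists_add_smul_neg_mem h'.1
  have h1 := h.inner_pivot_mul_le hnd hx he hθ
  have h2 := h.2.2 x' h'.1 h'.2.1
  have h3 := h'.2.2 x h.1 h.2.1
  rw [inner_sub_right, inner_add_right, inner_add_right, real_inner_smul_right,
    real_inner_smul_right, inner_neg_right, inner_neg_right, he'.1, h'.2.1,
    real_inner_comm e' y] at h1
  have : θ * inner ℝ e y ≤ θ * inner ℝ e' y := by linarith
  exact le_of_mul_le_mul_left this hθ0

/-- The vectors `y` for which the coefficient of `a k` lies in `R` when `y` is expanded in the tight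
rows of a vertex of the facet `k` at which `⟪y, ·⟫` is maximal over this facet. -/
def wallSet (a : Fin m → EuclideanSpace ℝ (Fin n)) (b : Fin m → ℝ) (k : Fin m) (R : Set ℝ) :
    Set (EuclideanSpace ℝ (Fin n)) :=
  {y | ∃ x ∈ (polyhedron a b).extremePoints ℝ, ∃ e, IsPivot a b k x e ∧ FacetMax a b k y x ∧
    inner ℝ e y ∈ R}

theorem wallSet_mono (k : Fin m) {R R' : Set ℝ} (h : R ⊆ R') :
    wallSet a b k R ⊆ wallSet a b k R' :=
  fun _ ⟨x, hx, e, he, hy, hR⟩ => ⟨x, hx, e, he, hy, h hR⟩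

theorem disjoint_wallSet (hnd : Nondegenerate a b) (k : Fin m) {R R' : Set ℝ}
    (h : Disjoint R R') : Disjoint (wallSet a b k R) (wallSet a b k R') := by
  rw [Set.disjoint_left]
  rintro y ⟨x, hx, e, he, hy, hR⟩ ⟨x', hx', e', he', hy', hR'⟩
  rw [le_antisymm (hy.inner_pivot_le hnd hx he hy' he')
    (hy'.inner_pivot_le hnd hx' he' hy he)] at hR
  exact Set.disjoint_left.1 h hR hR'

theorem add_smul_mem_wallSet {k : Fin m} {R R' : Set ℝ} {r : ℝ} (h : ∀ s ∈ R, s + r ∈ R')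
    {y : EuclideanSpace ℝ (Fin n)} (hy : y ∈ wallSet a b k R) : y + r • a k ∈ wallSet a b k R' := by
  obtain ⟨x, hx, e, he, hy, hR⟩ := hy
  refine ⟨x, hx, e, he, hy.add_smul r, ?_⟩
  rw [inner_add_right, real_inner_smul_right, real_inner_comm (a k) e, he.1, mul_one]
  exact h _ hR

/-- There are finitely many vertices, and at each of them the coefficient can be computed with one
fixed pivot vector `e₀`. -/
theorem measurableSet_wallSet (hnd : Nondegenerate a b) (k : Fin m) {R : Set ℝ}
    (hR : MeasurableSet R) : MeasurableSet (wallSet a b k R) := by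
  have : wallSet a b k R = ⋃ x ∈ (polyhedron a b).extremePoints ℝ,
      {y | ∃ e, IsPivot a b k x e ∧ FacetMax a b k y x ∧ inner ℝ e y ∈ R} := by
    ext y; simp [wallSet]
  rw [this]
  refine (finite_extremePoints_polyhedron a b).measurableSet_biUnion fun x hx => ?_
  by_cases h : ∃ e, IsPivot a b k x e
  · obtain ⟨e₀, he₀⟩ := h
    have : {y | ∃ e, IsPivot a b k x e ∧ FacetMax a b k y x ∧ inner ℝ e y ∈ R} =
        {y | FacetMax a b k y x} ∩ (fun y => inner ℝ e₀ y) ⁻¹' R := by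
      ext y
      constructor
      · rintro ⟨e, he, hy, hyR⟩
        refine ⟨hy, ?_⟩
        rw [Set.mem_preimage, le_antisymm (hy.inner_pivot_le hnd hx he₀ hy he)
          (hy.inner_pivot_le hnd hx he hy he₀)]
        exact hyR
      · exact fun h => ⟨e₀, he₀, h.1, h.2⟩
    rw [this]
    exact (isClosed_setOf_facetMax k x).measurableSet.inter
      (hR.preimage (by fun_prop))
  · have : {y | ∃ e, IsPivot a b k x e ∧ FacetMax a b k y x ∧ inner ℝ e y ∈ R} = ∅ :=
      Set.eq_empty_of_forall_notMem fun y ⟨e, he, _⟩ => h ⟨e, he⟩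
    rw [this]
    exact MeasurableSet.empty

/-- If several points maximize `⟪y, ·⟫` then `y` lies on a wall of the normal fan, and points near
`y` are near the same wall. -/
theorem eventually_exists_inner_pivot_eq_zero (hP : IsCompact (polyhedron a b))
    (hnd : Nondegenerate a b) {y p p' : EuclideanSpace ℝ (Fin n)}
    (hp : p ∈ maxFace (polyhedron a b) y) (hp' : p' ∈ maxFace (polyhedron a b) y) (hne : p ≠ p') :
    ∃ k, ∀ᶠ y' in 𝓝 y, ∃ x ∈ (polyhedron a b).extremePoints ℝ, ∃ e, IsPivot a b k x e ∧
      FacetMax a b k y' x ∧ inner ℝ e y = 0 := by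
  obtain ⟨x, hx, hxy⟩ := exists_extremePoint_mem_maxFace hP ⟨p, hp.1⟩ y
  obtain ⟨q, hq, hqx⟩ : ∃ q ∈ maxFace (polyhedron a b) y, q ≠ x := by
    by_cases h : p = x
    · exact ⟨p', hp', fun h' => hne (h.trans h'.symm)⟩
    · exact ⟨p, hp, h⟩
  -- The facet `k` contains one global maximizer, `x`, and misses another, `q`. The first makes
  -- facet maxima global maxima; together they force the coefficient to vanish.
  obtain ⟨k, hk, hqk⟩ : ∃ k, inner ℝ (a k) x = b k ∧ inner ℝ (a k) q ≠ b k := by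
    by_contra! h
    exact hqx (eq_of_tight hx h)
  have hqk : inner ℝ (a k) q < b k := lt_of_le_of_ne (hq.1 k) hqk
  refine ⟨k, ?_⟩
  have hev : ∀ᶠ y' in 𝓝 y, ∀ z ∈ (polyhedron a b).extremePoints ℝ, FacetMax a b k y' z →
      FacetMax a b k y z := by
    rw [(finite_extremePoints_polyhedron a b).eventually_all]
    intro z _
    by_cases hz : FacetMax a b k y z
    · exact Eventually.of_forall fun _ _ => hz
    · exact ((isClosed_setOf_facetMax k z).isOpen_compl.eventually_mem hz).mono
        fun y' h h' => absurd h' h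
  filter_upwards [hev] with y' hy'
  obtain ⟨z, hz, hzmax⟩ := exists_facetMax hP hx.1 hk y'
  have hzy := hy' z hz hzmax
  obtain ⟨e, he⟩ := exists_isPivot hnd hz hzmax.2.1
  refine ⟨z, hz, e, he, hzmax, ?_⟩
  have hxz : inner ℝ y x ≤ inner ℝ y z := hzy.2.2 x hx.1 hk
  refine le_antisymm ?_ ?_
  -- A positive coefficient would make `q`, which is off the facet, strictly worse than `z`.
  · have h1 := hzy.inner_pivot_mul_le hnd hz he hq.1
    have h2 := hq.2 z hz.1
    rw [inner_sub_right] at h1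
    by_contra! h
    have := mul_pos h (sub_pos.2 hqk)
    linarith
  -- A negative coefficient would make the edge leaving the facet at `z` improve on the global
  -- maximum.
  · obtain ⟨θ, hθ0, hθ⟩ := he.exists_add_smul_neg_mem hz.1
    have h1 := hxy.2 _ hθ
    rw [inner_add_right, real_inner_smul_right, inner_neg_right,
      real_inner_comm e y] at h1
    nlinarith

/-- A coefficient in an expansion into rows is at most `‖y‖ / δ`. -/
theorem DeltaDistanceProperty.abs_mul_le {δ : ℝ} (hδ : DeltaDistanceProperty a δ) {I : Set (Fin m)}
    {k : Fin m} (hk : a k ∉ Submodule.span ℝ (a '' I)) {κ : ℝ} {y z : EuclideanSpace ℝ (Fin n)}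
    (hz : z ∈ Submodule.span ℝ (a '' I)) (hy : y = κ • a k + z) : |κ| * δ ≤ ‖y‖ := by
  rcases eq_or_ne κ 0 with rfl | hκ
  · simp
  · have h1 : δ ≤ dist (a k) (-(κ⁻¹ • z)) :=
      (hδ I k hk).trans (Metric.infDist_le_dist_of_mem (Submodule.neg_mem _
        (Submodule.smul_mem _ _ hz)))
    have h2 : y = κ • (a k - -(κ⁻¹ • z)) := by
      rw [hy, sub_neg_eq_add, smul_add, smul_inv_smul₀ hκ]
    rw [h2, norm_smul, Real.norm_eq_abs, ← dist_eq_norm]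
    exact mul_le_mul_of_nonneg_left h1 (abs_nonneg κ)

/-- The inner product is the coefficient of `a k` in the tight rows, and `a k` is outside the span
of the others because `e` annihilates that span. -/
theorem IsPivot.abs_inner_mul_le {δ : ℝ} (hδ : DeltaDistanceProperty a δ)
    (hnd : Nondegenerate a b) {k : Fin m} {x e : EuclideanSpace ℝ (Fin n)}
    (hx : x ∈ (polyhedron a b).extremePoints ℝ) (hk : inner ℝ (a k) x = b k)
    (he : IsPivot a b k x e) (y : EuclideanSpace ℝ (Fin n)) : |inner ℝ e y| * δ ≤ ‖y‖ := by
  classical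
  obtain ⟨g, hgk, hg⟩ := exists_isPivot_family hnd hx hk he
  have hsum := sum_pivot_smul hnd hx hg y
  rw [← Finset.add_sum_erase _ _ (Finset.mem_univ ⟨k, hk⟩), hgk] at hsum
  refine hδ.abs_mul_le (I := {i | inner ℝ (a i) x = b i ∧ i ≠ k}) ?_ ?_ hsum.symm
  · intro h
    have h1 := inner_eq_zero_of_mem_span (e := e) (by
      rintro _ ⟨i, hi, rfl⟩
      exact he.2 i hi.1 hi.2) h
    rw [he.1] at h1
    exact one_ne_zero h1
  · refine Submodule.sum_mem _ fun i hi => Submodule.smul_mem _ _ (Submodule.subset_span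
      ⟨i.1, ⟨i.2, fun h => Finset.ne_of_mem_erase hi (Subtype.ext h)⟩, rfl⟩)

end Polytope

/-! ### Uniform laws on boxes under translation. -/

section Shift

variable {n : ℕ}

theorem pi_cond {S : Fin n → Set ℝ} (hS : ∀ i, MeasurableSet (S i))
    (h0 : ∀ i, volume (S i) ≠ 0) (htop : ∀ i, volume (S i) ≠ ∞) :
    Measure.pi (fun i => (volume : Measure ℝ)[|S i]) =
      (volume : Measure (Fin n → ℝ))[|Set.univ.pi S] := by
  have : ∀ i, IsProbabilityMeasure ((volume : Measure ℝ)[|S i]) := fun i =>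
    cond_isProbabilityMeasure_of_finite (h0 i) (htop i)
  refine Measure.pi_eq fun t _ => ?_
  rw [cond_apply (MeasurableSet.univ_pi hS), ← Set.pi_inter_distrib, volume_pi_pi, volume_pi_pi]
  simp only [cond_apply (hS _)]
  rw [Finset.prod_mul_distrib, ENNReal.prod_inv_distrib]
  exact fun i _ j _ _ => Or.inl (h0 i)

theorem volume_shift_sdiff_Icc_le (l w t : ℝ) :
    volume {x | x - t ∈ Set.Icc l (l + w) ∧ x ∉ Set.Icc l (l + w)} ≤ ENNReal.ofReal |t| := by
  rcases le_total 0 t with ht | ht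
  · refine (measure_mono (t := Set.Icc (l + w) (l + w + t)) ?_).trans ?_
    · rintro x ⟨h1, h2⟩
      simp only [Set.mem_Icc, not_and, not_le] at h1 h2 ⊢
      exact ⟨(h2 (by linarith)).le, by linarith⟩
    · rw [Real.volume_Icc, abs_of_nonneg ht, add_sub_cancel_left]
  · refine (measure_mono (t := Set.Icc (l + t) l) ?_).trans ?_
    · rintro x ⟨h1, h2⟩
      simp only [Set.mem_Icc, not_and, not_le] at h1 h2 ⊢
      refine ⟨by linarith, ?_⟩
      by_contra! h
      have := h2 h.le
      linarith
    · rw [Real.volume_Icc, abs_of_nonpos ht]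
      exact ENNReal.ofReal_le_ofReal (by linarith)

theorem volume_shift_sdiff_Ioc_le (l w t : ℝ) :
    volume {x | x - t ∈ Set.Ioc l (l + w) ∧ x ∉ Set.Ioc l (l + w)} ≤ ENNReal.ofReal |t| := by
  rcases le_total 0 t with ht | ht
  · refine (measure_mono (t := Set.Icc (l + w) (l + w + t)) ?_).trans ?_
    · rintro x ⟨h1, h2⟩
      simp only [Set.mem_Icc, Set.mem_Ioc, not_and, not_le] at h1 h2 ⊢
      exact ⟨(h2 (by linarith)).le, by linarith⟩
    · rw [Real.volume_Icc, abs_of_nonneg ht, add_sub_cancel_left]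
  · refine (measure_mono (t := Set.Icc (l + t) l) ?_).trans ?_
    · rintro x ⟨h1, h2⟩
      simp only [Set.mem_Icc, Set.mem_Ioc, not_and, not_le] at h1 h2 ⊢
      refine ⟨by linarith, ?_⟩
      by_contra! h
      have := h2 h
      linarith
    · rw [Real.volume_Icc, abs_of_nonpos ht]
      exact ENNReal.ofReal_le_ofReal (by linarith)

/-- The part of a translated box outside of the box. -/
theorem volume_shift_sdiff_pi_le {S : Fin n → Set ℝ} {w : ℝ}
    (hvol : ∀ i, volume (S i) = ENNReal.ofReal w)
    (hshift : ∀ i t, volume {x | x - t ∈ S i ∧ x ∉ S i} ≤ ENNReal.ofReal |t|) (α : Fin n → ℝ) :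
    volume {x | x - α ∈ Set.univ.pi S ∧ x ∉ Set.univ.pi S} ≤
      (∑ j, ENNReal.ofReal |α j|) * ENNReal.ofReal w ^ (n - 1) := by
  classical
  have hsub : {x | x - α ∈ Set.univ.pi S ∧ x ∉ Set.univ.pi S} ⊆
      ⋃ j, Set.univ.pi (Function.update (fun i => {x | x - α i ∈ S i}) j
        {x | x - α j ∈ S j ∧ x ∉ S j}) := by
    rintro x ⟨h1, h2⟩
    simp only [Set.mem_pi, Set.mem_univ, true_implies, not_forall, Pi.sub_apply] at h1 h2
    obtain ⟨j, hj⟩ := h2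
    refine Set.mem_iUnion.2 ⟨j, fun i _ => ?_⟩
    by_cases hij : i = j
    · subst hij; rw [Function.update_self]; exact ⟨h1 i, hj⟩
    · rw [Function.update_of_ne hij]; exact h1 i
  refine (measure_mono hsub).trans ((measure_iUnion_le _).trans ?_)
  rw [tsum_fintype, Finset.sum_mul]
  refine Finset.sum_le_sum fun j _ => ?_
  rw [volume_pi_pi, ← Finset.mul_prod_erase _ _ (Finset.mem_univ j), Function.update_self]
  refine mul_le_mul' (hshift j (α j)) ?_
  rw [Finset.prod_congr rfl (g := fun _ => ENNReal.ofReal w)]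
  · rw [Finset.prod_const, Finset.card_erase_of_mem (Finset.mem_univ j), Finset.card_univ,
      Fintype.card_fin]
  · intro i hi
    rw [Function.update_of_ne (Finset.ne_of_mem_erase hi), ← hvol i]
    have : {x | x - α i ∈ S i} = (fun x => x + -α i) ⁻¹' S i := by
      ext x; simp [sub_eq_add_neg]
    rw [this, measure_preimage_add_right]

/-- If translation by `α` maps `A` into `A'`, then `A \ A'` has small probability under the uniform
distribution on a box. -/
theorem pi_cond_le_of_shift {S : Fin n → Set ℝ} {w : ℝ} (hw : 0 < w)
    (hS : ∀ i, MeasurableSet (S i)) (hvol : ∀ i, volume (S i) = ENNReal.ofReal w)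
    (hshift : ∀ i t, volume {x | x - t ∈ S i ∧ x ∉ S i} ≤ ENNReal.ofReal |t|)
    {A A' B : Set (Fin n → ℝ)} {α : Fin n → ℝ} (hA' : MeasurableSet A')
    (hAα : ∀ x ∈ A, x + α ∈ A') (hBA : B ⊆ A) (hA'A : A' ⊆ A) (hBA' : Disjoint B A') :
    Measure.pi (fun i => (volume : Measure ℝ)[|S i]) B ≤ ENNReal.ofReal ((∑ j, |α j|) / w) := by
  have hw0 : ENNReal.ofReal w ≠ 0 := by simpa using hw
  have hCvol : volume (Set.univ.pi S) = ENNReal.ofReal w ^ n := by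
    rw [volume_pi_pi, Finset.prod_congr rfl fun i _ => hvol i]; simp
  have hC : MeasurableSet (Set.univ.pi S) := MeasurableSet.univ_pi hS
  rw [pi_cond hS (fun i => hvol i ▸ hw0) (fun i => hvol i ▸ ENNReal.ofReal_ne_top),
    cond_apply hC, hCvol]
  -- Translating the left-hand set by `α` lands in `A'`, apart from the part pushed out of the box.
  have h1 : volume (Set.univ.pi S ∩ A) ≤ volume (Set.univ.pi S ∩ A') +
      (∑ j, ENNReal.ofReal |α j|) * ENNReal.ofReal w ^ (n - 1) := by
    calc volume (Set.univ.pi S ∩ A)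
        = volume ((fun x => x + -α) ⁻¹' (Set.univ.pi S ∩ A)) :=
          (measure_preimage_add_right _ _ _).symm
      _ ≤ volume (Set.univ.pi S ∩ A' ∪ {x | x - α ∈ Set.univ.pi S ∧ x ∉ Set.univ.pi S}) := by
          refine measure_mono fun x hx => ?_
          have hx1 : x - α ∈ Set.univ.pi S := by rw [sub_eq_add_neg]; exact hx.1
          have hx2 : x ∈ A' := by simpa using hAα _ hx.2
          by_cases h : x ∈ Set.univ.pi S
          · exact Or.inl ⟨h, hx2⟩
          · exact Or.inr ⟨hx1, h⟩
      _ ≤ _ := (measure_union_le _ _).trans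
          (add_le_add_right (volume_shift_sdiff_pi_le hvol hshift α) _)
  -- Combined with `h1`, the finite volume of the `A'` part cancels and only the overhang is left to
  -- bound `B`.
  have h2 : volume (Set.univ.pi S ∩ B) + volume (Set.univ.pi S ∩ A') ≤
      volume (Set.univ.pi S ∩ A) := by
    rw [← measure_union (hBA'.mono Set.inter_subset_right Set.inter_subset_right) (hC.inter hA')]
    exact measure_mono (Set.union_subset (Set.inter_subset_inter_right _ hBA)
      (Set.inter_subset_inter_right _ hA'A))
  have hfin : volume (Set.univ.pi S ∩ A') ≠ ∞ := by
    refine ne_top_of_le_ne_top ?_ (measure_mono Set.inter_subset_left)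
    rw [hCvol]; finiteness
  have h3 : volume (Set.univ.pi S ∩ B) ≤
      (∑ j, ENNReal.ofReal |α j|) * ENNReal.ofReal w ^ (n - 1) := by
    have := h2.trans h1
    rw [add_comm] at this
    exact (ENNReal.add_le_add_iff_left hfin).1 this
  refine (mul_le_mul_right h3 _).trans ?_
  rw [ENNReal.ofReal_div_of_pos hw, ENNReal.ofReal_sum_of_nonneg fun _ _ => abs_nonneg _]
  rcases Nat.eq_zero_or_pos n with rfl | hn
  · simp
  · rw [mul_comm, mul_assoc, div_eq_mul_inv]
    refine mul_le_mul_right (le_of_eq ?_) _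
    obtain ⟨k, rfl⟩ := Nat.exists_eq_add_of_le' hn
    rw [Nat.add_sub_cancel, pow_succ, ENNReal.mul_inv (Or.inl (by positivity))
      (Or.inl (by finiteness)), ← mul_assoc, ENNReal.mul_inv_cancel (by positivity) (by finiteness),
      one_mul]

variable {m : ℕ} {a : Fin m → EuclideanSpace ℝ (Fin n)} {b : Fin m → ℝ}

/-- The shift `2 * η • α` of the random vector adds `2 * η` to the coefficient of `a k`, carrying
everything above `-η` to at least `η`. The slab is the part lost. -/
theorem pi_cond_wallSet_le {S : Fin n → Set ℝ} {w : ℝ} (hw : 0 < w)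
    (hS : ∀ i, MeasurableSet (S i)) (hvol : ∀ i, volume (S i) = ENNReal.ofReal w)
    (hshift : ∀ i t, volume {x | x - t ∈ S i ∧ x ∉ S i} ≤ ENNReal.ofReal |t|)
    (hnd : Nondegenerate a b) {k : Fin m} {Y : (Fin n → ℝ) → EuclideanSpace ℝ (Fin n)}
    (hY : Measurable Y) {α : Fin n → ℝ} (hYα : ∀ x (r : ℝ), Y (x + r • α) = Y x + r • a k)
    {η : ℝ} (hη : 0 < η) :
    Measure.pi (fun i => (volume : Measure ℝ)[|S i]) (Y ⁻¹' wallSet a b k (Set.Ioo (-η) η)) ≤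
      ENNReal.ofReal (2 * η * ((∑ j, |α j|) / w)) := by
  have h := pi_cond_le_of_shift hw hS hvol hshift (A := Y ⁻¹' wallSet a b k (Set.Ioi (-η)))
    (A' := Y ⁻¹' wallSet a b k (Set.Ici η)) (B := Y ⁻¹' wallSet a b k (Set.Ioo (-η) η))
    (α := (2 * η) • α) ((measurableSet_wallSet hnd k measurableSet_Ici).preimage hY) ?_ ?_ ?_ ?_
  · refine h.trans (le_of_eq ?_)
    simp only [Pi.smul_apply, smul_eq_mul, abs_mul, ← Finset.mul_sum]
    rw [abs_of_pos two_pos, abs_of_pos hη, mul_div_assoc]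
  · intro x hx
    rw [Set.mem_preimage, hYα]
    refine add_smul_mem_wallSet (R := Set.Ioi (-η)) (fun s hs => ?_) hx
    have : -η < s := hs
    exact Set.mem_Ici.2 (by linarith)
  · exact Set.preimage_mono (wallSet_mono k Set.Ioo_subset_Ioi_self)
  · refine Set.preimage_mono (wallSet_mono k fun s hs => ?_)
    have : η ≤ s := hs
    exact Set.mem_Ioi.2 (by linarith)
  · refine (disjoint_wallSet hnd k ?_).preimage Y
    rw [Set.disjoint_left]
    exact fun s hs hs' => not_le_of_gt hs.2 hs'

end Shift

/-! ### Breakpoints of the parametric maximum and their expected number. -/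

section Breaks

variable {n m : ℕ} {a : Fin m → EuclideanSpace ℝ (Fin n)} {b : Fin m → ℝ}

/-- The parameters `s` at which the slope of `s ↦ max_{x ∈ P} ⟪p + s q, x⟫` changes. -/
def breaks (P : Set (EuclideanSpace ℝ (Fin n))) (p q : EuclideanSpace ℝ (Fin n)) : Set ℝ :=
  {s | ∃ x ∈ maxFace P (p + s • q), ∃ x' ∈ maxFace P (p + s • q), inner ℝ q x ≠ inner ℝ q x'}

theorem mem_breaks_iff {P : Set (EuclideanSpace ℝ (Fin n))} (hP : IsCompact P)
    {p q : EuclideanSpace ℝ (Fin n)} {s : ℝ} :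
    s ∈ breaks P p q ↔ ∃ x ∈ P.extremePoints ℝ, ∃ x' ∈ P.extremePoints ℝ,
      x ∈ maxFace P (p + s • q) ∧ x' ∈ maxFace P (p + s • q) ∧ inner ℝ q x ≠ inner ℝ q x' := by
  constructor
  · rintro ⟨x, hx, x', hx', hne⟩
    have hF := IsCompact.maxFace hP (p + s • q)
    -- Vertices with the largest and the smallest value of `q` on the optimal face: if these values
    -- agree, `q` is constant there.
    obtain ⟨z, hz, hzmax⟩ := exists_extremePoint_mem_maxFace hF ⟨x, hx⟩ q
    obtain ⟨z', hz', hzmax'⟩ := exists_extremePoint_mem_maxFace hF ⟨x, hx⟩ (-q)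
    have hE := (isExtreme_maxFace P (p + s • q)).extremePoints_subset_extremePoints
    refine ⟨z, hE hz, z', hE hz', hzmax.1, hzmax'.1, fun h => hne ?_⟩
    have h1 := hzmax.2 x hx
    have h2 := hzmax.2 x' hx'
    have h3 := hzmax'.2 x hx
    have h4 := hzmax'.2 x' hx'
    simp only [inner_neg_left] at h3 h4
    linarith
  · rintro ⟨x, -, x', -, hx, hx', hne⟩
    exact ⟨x, hx, x', hx', hne⟩

theorem eq_div_of_mem_maxFace {P : Set (EuclideanSpace ℝ (Fin n))}
    {p q x x' : EuclideanSpace ℝ (Fin n)} {s : ℝ} (hx : x ∈ maxFace P (p + s • q))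
    (hx' : x' ∈ maxFace P (p + s • q)) (hne : inner ℝ q x ≠ inner ℝ q x') :
    s = (inner ℝ p x - inner ℝ p x') / (inner ℝ q x' - inner ℝ q x) := by
  have h := le_antisymm (hx.2 x' hx'.1) (hx'.2 x hx.1)
  simp only [inner_add_left, real_inner_smul_left] at h
  rw [eq_div_iff (sub_ne_zero.2 hne.symm)]
  linarith

theorem finite_breaks (hP : IsCompact (polyhedron a b)) (p q : EuclideanSpace ℝ (Fin n)) :
    (breaks (polyhedron a b) p q).Finite := by
  have hV := finite_extremePoints_polyhedron a b
  refine ((hV.prod hV).image fun z =>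
    (inner ℝ p z.1 - inner ℝ p z.2) / (inner ℝ q z.2 - inner ℝ q z.1)).subset fun s hs => ?_
  obtain ⟨x, hx, x', hx', h1, h2, h3⟩ := (mem_breaks_iff hP).1 hs
  exact ⟨(x, x'), ⟨hx, hx'⟩, (eq_div_of_mem_maxFace h1 h2 h3).symm⟩

theorem swap_mem_breaks {P : Set (EuclideanSpace ℝ (Fin n))} {p q : EuclideanSpace ℝ (Fin n)}
    {s : ℝ} (hs : 0 < s) (h : s ∈ breaks P p q) : s⁻¹ ∈ breaks P q p := by
  have key : ∀ x, x ∈ maxFace P (p + s • q) → x ∈ maxFace P (q + s⁻¹ • p) := by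
    rintro x ⟨hx, hmax⟩
    refine ⟨hx, fun z hz => ?_⟩
    have h1 := mul_le_mul_of_nonneg_left (hmax z hz) (inv_pos.2 hs).le
    have h2 : q + s⁻¹ • p = s⁻¹ • (p + s • q) := by
      rw [smul_add, inv_smul_smul₀ hs.ne', add_comm]
    rwa [h2, real_inner_smul_left, real_inner_smul_left]
  obtain ⟨x, hx, x', hx', hne⟩ := h
  refine ⟨x, key x hx, x', key x' hx', fun h' => hne ?_⟩
  have h := le_antisymm (hx.2 x' hx'.1) (hx'.2 x hx.1)
  simp only [inner_add_left, real_inner_smul_left] at h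
  exact mul_left_cancel₀ hs.ne' (by linarith)

theorem encard_breaks_Ioi_le {P : Set (EuclideanSpace ℝ (Fin n))} {p q : EuclideanSpace ℝ (Fin n)}
    {T : ℝ} (hT : 0 < T) : (breaks P p q ∩ Set.Ioi 0).encard ≤
      (breaks P p q ∩ Set.Ioc 0 T).encard + (breaks P q p ∩ Set.Ioc 0 T⁻¹).encard := by
  have : breaks P p q ∩ Set.Ioi 0 ⊆
      (breaks P p q ∩ Set.Ioc 0 T) ∪ (fun s => s⁻¹) '' (breaks P q p ∩ Set.Ioc 0 T⁻¹) := by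
    rintro s ⟨hs, hs0⟩
    have hs0 : 0 < s := hs0
    rcases le_or_gt s T with h | h
    · exact Or.inl ⟨hs, hs0, h⟩
    · exact Or.inr ⟨s⁻¹, ⟨swap_mem_breaks hs0 hs, inv_pos.2 hs0, inv_anti₀ hT h.le⟩, inv_inv s⟩
  exact (Set.encard_le_encard this).trans ((Set.encard_union_le _ _).trans
    (add_le_add le_rfl (Set.encard_image_le _ _)))

/-- The coefficient vanishes at `s` and equals `(t - s) * ⟪e, q⟫` at `t`, where the distance
property bounds the second factor by `L`. -/
theorem eventually_mem_wallSet (hP : IsCompact (polyhedron a b)) (hnd : Nondegenerate a b)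
    {δ : ℝ} (hδ : 0 < δ) (hdist : DeltaDistanceProperty a δ) {p q : EuclideanSpace ℝ (Fin n)}
    {L : ℝ} (hL : 0 < L) (hq : ‖q‖ ≤ L * δ) {s : ℝ} (hs : s ∈ breaks (polyhedron a b) p q) :
    ∃ k, ∀ᶠ t in 𝓝 s, ∀ ε, |t - s| < ε →
      p + t • q ∈ wallSet a b k (Set.Ioo (-(L * ε)) (L * ε)) := by
  obtain ⟨x, hx, x', hx', hne⟩ := hs
  obtain ⟨k, hk⟩ := eventually_exists_inner_pivot_eq_zero hP hnd hx hx' (fun h => hne (by rw [h]))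
  have hc : Tendsto (fun t : ℝ => p + t • q) (𝓝 s) (𝓝 (p + s • q)) :=
    Continuous.tendsto (by fun_prop) s
  refine ⟨k, (hc.eventually hk).mono ?_⟩
  rintro t ⟨z, hz, e, he, hmax, h0⟩ ε hε
  refine ⟨z, hz, e, he, hmax, ?_⟩
  have h1 : inner ℝ e (p + t • q) = (t - s) * inner ℝ e q := by
    have : p + t • q = (p + s • q) + (t - s) • q := by module
    rw [this, inner_add_right, h0, real_inner_smul_right, zero_add]
  have h2 : |inner ℝ e q| ≤ L :=
    le_of_mul_le_mul_right ((he.abs_inner_mul_le hdist hnd hz hmax.2.1 q).trans hq) hδ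
  rw [Set.mem_Ioo, ← abs_lt, h1, abs_mul, mul_comm L]
  calc |t - s| * |inner ℝ e q| ≤ |t - s| * L := by gcongr
    _ < ε * L := by gcongr

/-- The number of pairs of a grid point and a wall of the normal fan near the grid point. -/
noncomputable def gridCount (a : Fin m → EuclideanSpace ℝ (Fin n)) (b : Fin m → ℝ) (L T : ℝ)
    (p q : EuclideanSpace ℝ (Fin n)) (N : ℕ) : ℝ≥0∞ :=
  ∑ j ∈ Finset.Icc 1 N, ∑ k : Fin m,
    Set.indicator (wallSet a b k (Set.Ioo (-(L * (T / N))) (L * (T / N)))) 1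
      (p + (j * (T / N) : ℝ) • q)

/-- Each of the finitely many breakpoints is rounded to a grid point. On a fine grid these points
are distinct and each lies in a slab, so every breakpoint pays for its own term of the sum. -/
theorem eventually_encard_le_gridCount (hP : IsCompact (polyhedron a b)) (hnd : Nondegenerate a b)
    {δ : ℝ} (hδ : 0 < δ) (hdist : DeltaDistanceProperty a δ) {p q : EuclideanSpace ℝ (Fin n)}
    {L T : ℝ} (hL : 0 < L) (hT : 0 < T) (hq : ‖q‖ ≤ L * δ) :
    ∀ᶠ N : ℕ in atTop, (((breaks (polyhedron a b) p q ∩ Set.Ioc 0 T).encard : ℕ∞) : ℝ≥0∞) ≤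
      gridCount a b L T p q N := by
  classical
  have hfin : (breaks (polyhedron a b) p q ∩ Set.Ioc 0 T).Finite :=
    (finite_breaks hP p q).inter_of_left _
  obtain ⟨F, hF⟩ := hfin.exists_finset_coe
  have hFs : ∀ s ∈ F, s ∈ breaks (polyhedron a b) p q ∧ 0 < s ∧ s ≤ T := by
    intro s hs
    have : s ∈ (F : Set ℝ) := hs
    rw [hF] at this
    exact ⟨this.1, this.2.1, this.2.2⟩
  -- Rounding up keeps the index in `1, …, N` for `s` in `(0, T]` and moves `s` by strictly less
  -- than one mesh width.
  let J : ℕ → ℝ → ℕ := fun N s => ⌈s / (T / N)⌉₊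
  let t : ℕ → ℝ → ℝ := fun N s => J N s * (T / N)
  have hclose : ∀ s ∈ F, ∀ N : ℕ, 1 ≤ N → |t N s - s| < T / N := by
    intro s hs N hN
    have hN0 : (0 : ℝ) < N := by exact_mod_cast hN
    have hpos : 0 < T / N := by positivity
    have h1 : s / (T / N) ≤ J N s := Nat.le_ceil _
    have h2 : (J N s : ℝ) < s / (T / N) + 1 :=
      Nat.ceil_lt_add_one (div_nonneg (hFs s hs).2.1.le hpos.le)
    rw [div_le_iff₀ hpos] at h1
    have h3 := mul_lt_mul_of_pos_right h2 hpos
    rw [add_mul, div_mul_cancel₀ _ hpos.ne', one_mul] at h3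
    rw [abs_lt]
    constructor
    · simp only [t]; linarith
    · simp only [t]; linarith
  have hlim : ∀ s ∈ F, Tendsto (fun N => t N s) atTop (𝓝 s) := by
    intro s hs
    rw [tendsto_iff_norm_sub_tendsto_zero]
    refine squeeze_zero' (Eventually.of_forall fun _ => norm_nonneg _) ?_
      (tendsto_const_div_atTop_nhds_zero_nat T)
    filter_upwards [eventually_ge_atTop 1] with N hN
    exact (hclose s hs N hN).le
  have hwall : ∀ᶠ N in atTop, ∀ s ∈ F, ∃ k, ∀ ε, |t N s - s| < ε →
      p + t N s • q ∈ wallSet a b k (Set.Ioo (-(L * ε)) (L * ε)) := by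
    refine (Filter.eventually_all_finset F).2 fun s hs => ?_
    obtain ⟨k, hk⟩ := eventually_mem_wallSet hP hnd hδ hdist hL hq (hFs s hs).1
    exact ((hlim s hs).eventually hk).mono fun _ h => ⟨k, h⟩
  have hinj : ∀ᶠ N in atTop, ∀ s ∈ F, ∀ s' ∈ F, s ≠ s' → t N s ≠ t N s' := by
    refine (Filter.eventually_all_finset F).2 fun s hs =>
      (Filter.eventually_all_finset F).2 fun s' hs' => ?_
    by_cases hss : s = s'
    · exact Eventually.of_forall fun _ h => absurd hss h
    · exact (((hlim s hs).sub (hlim s' hs')).eventually_ne (sub_ne_zero.2 hss)).mono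
        fun _ h _ => sub_ne_zero.1 h
  filter_upwards [hwall, hinj, eventually_ge_atTop 1] with N hwall hinj hN
  have hN0 : (0 : ℝ) < N := by exact_mod_cast hN
  have hpos : 0 < T / N := by positivity
  rw [← hF, Set.encard_coe_eq_coe_finsetCard, ENat.toENNReal_coe]
  have hJinj : Set.InjOn (J N) F := by
    intro s hs s' hs' h
    by_contra hne
    exact hinj s hs s' hs' hne (by simp only [t, h])
  have hJmem : F.image (J N) ⊆ Finset.Icc 1 N := by
    intro j hj
    obtain ⟨s, hs, rfl⟩ := Finset.mem_image.1 hj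
    rw [Finset.mem_Icc]
    refine ⟨Nat.one_le_ceil_iff.2 (div_pos (hFs s hs).2.1 hpos), Nat.ceil_le.2 ?_⟩
    rw [div_le_iff₀ hpos, mul_div_cancel₀ _ hN0.ne']
    exact (hFs s hs).2.2
  calc (F.card : ℝ≥0∞) = ∑ s ∈ F, 1 := by simp
    _ ≤ ∑ s ∈ F, ∑ k : Fin m,
        Set.indicator (wallSet a b k (Set.Ioo (-(L * (T / N))) (L * (T / N)))) 1
          (p + (J N s * (T / N) : ℝ) • q) := by
        refine Finset.sum_le_sum fun s hs => ?_
        obtain ⟨k, hk⟩ := hwall s hs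
        refine le_trans ?_ (Finset.single_le_sum (fun _ _ => zero_le) (Finset.mem_univ k))
        rw [Set.indicator_of_mem (hk _ (hclose s hs N hN))]
        rfl
    _ = ∑ j ∈ F.image (J N), ∑ k : Fin m,
        Set.indicator (wallSet a b k (Set.Ioo (-(L * (T / N))) (L * (T / N)))) 1
          (p + (j * (T / N) : ℝ) • q) := by
        rw [Finset.sum_image hJinj]
    _ ≤ _ := Finset.sum_le_sum_of_subset hJmem

/-- The expected number of breakpoints in `(0, T]` when `p + t q` is unlikely to be near a wall. -/
theorem lintegral_encard_breaks_le {Ω : Type*} [MeasurableSpace Ω] (μ : Measure Ω)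
    (hP : IsCompact (polyhedron a b)) (hnd : Nondegenerate a b) {δ : ℝ} (hδ : 0 < δ)
    (hdist : DeltaDistanceProperty a δ) {p q : Ω → EuclideanSpace ℝ (Fin n)}
    (hp : Measurable p) (hq : Measurable q) {L T D : ℝ} (hL : 0 < L) (hT : 0 < T)
    (hqL : ∀ᵐ ω ∂μ, ‖q ω‖ ≤ L * δ)
    (hD : ∀ k (t η : ℝ), 0 < t → 0 < η →
      μ ((fun ω => p ω + t • q ω) ⁻¹' wallSet a b k (Set.Ioo (-η) η)) ≤
        ENNReal.ofReal (2 * η * D)) :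
    ∫⁻ ω, ((breaks (polyhedron a b) (p ω) (q ω) ∩ Set.Ioc 0 T).encard : ℕ∞) ∂μ ≤
      ENNReal.ofReal (2 * m * L * T * D) := by
  have hmeasW : ∀ (k : Fin m) (η t : ℝ),
      MeasurableSet ((fun ω => p ω + t • q ω) ⁻¹' wallSet a b k (Set.Ioo (-η) η)) :=
    fun k η t => (measurableSet_wallSet hnd k measurableSet_Ioo).preimage
      (hp.add (hq.const_smul t))
  have hmeasI : ∀ (k : Fin m) (η t : ℝ), Measurable fun ω =>
      Set.indicator (wallSet a b k (Set.Ioo (-η) η)) (1 : EuclideanSpace ℝ (Fin n) → ℝ≥0∞) (p ω + t • q ω) :=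
    fun k η t => (measurable_one.indicator
      (measurableSet_wallSet hnd k measurableSet_Ioo)).comp (hp.add (hq.const_smul t))
  have hmeas : ∀ N, Measurable fun ω => gridCount a b L T (p ω) (q ω) N := by
    intro N
    exact Finset.measurable_fun_sum _ fun j _ => Finset.measurable_fun_sum _ fun k _ =>
      hmeasI k _ _
  calc ∫⁻ ω, ((breaks (polyhedron a b) (p ω) (q ω) ∩ Set.Ioc 0 T).encard : ℕ∞) ∂μ
      ≤ ∫⁻ ω, liminf (fun N => gridCount a b L T (p ω) (q ω) N) atTop ∂μ := by
        refine lintegral_mono_ae ?_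
        filter_upwards [hqL] with ω hω
        exact le_liminf_of_le (by isBoundedDefault)
          (eventually_encard_le_gridCount hP hnd hδ hdist hL hT hω)
    _ ≤ liminf (fun N => ∫⁻ ω, gridCount a b L T (p ω) (q ω) N ∂μ) atTop :=
        -- Fatou is needed because the fineness at which the grid count becomes valid depends on
        -- `ω`.
        lintegral_liminf_le hmeas
    _ ≤ liminf (fun _ : ℕ => ENNReal.ofReal (2 * m * L * T * D)) atTop := by
        refine liminf_le_liminf ?_
        filter_upwards [eventually_ge_atTop 1] with N hN
        have hN0 : (0 : ℝ) < N := by exact_mod_cast hN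
        have hpos : 0 < T / N := by positivity
        simp only [gridCount]
        rw [lintegral_finsetSum _ fun j _ => Finset.measurable_fun_sum _ fun k _ => hmeasI k _ _]
        have hterm : ∀ j ∈ Finset.Icc 1 N, ∫⁻ ω, ∑ k : Fin m,
            Set.indicator (wallSet a b k (Set.Ioo (-(L * (T / N))) (L * (T / N)))) 1
              (p ω + (j * (T / N) : ℝ) • q ω) ∂μ ≤
            m * ENNReal.ofReal (2 * (L * (T / N)) * D) := by
          intro j hj
          rw [lintegral_finsetSum _ fun k _ => hmeasI k _ _]
          refine (Finset.sum_le_card_nsmul _ _ (ENNReal.ofReal (2 * (L * (T / N)) * D))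
            fun k _ => ?_).trans (le_of_eq ?_)
          · refine le_trans (le_of_eq ?_) (hD k (j * (T / N)) (L * (T / N)) (mul_pos
              (by exact_mod_cast (Finset.mem_Icc.1 hj).1) hpos) (mul_pos hL hpos))
            rw [← lintegral_indicator_one (hmeasW k _ _)]
            rfl
          · rw [nsmul_eq_mul, Finset.card_univ, Fintype.card_fin]
        refine (Finset.sum_le_card_nsmul _ _ _ hterm).trans (le_of_eq ?_)
        rw [nsmul_eq_mul, Nat.card_Icc, Nat.add_sub_cancel, ← mul_assoc,
          ← ENNReal.ofReal_natCast N, ← ENNReal.ofReal_natCast m,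
          ← ENNReal.ofReal_mul (by positivity), ← ENNReal.ofReal_mul (by positivity)]
        congr 1
        field_simp
    _ = _ := liminf_const _

/-- The number of distinct values of finitely many partially defined random variables. -/
theorem measurable_encard_setOf {Ω ι : Type*} [MeasurableSpace Ω] (I : Finset ι)
    {U : ι → Set Ω} (hU : ∀ i ∈ I, MeasurableSet (U i)) {f : ι → Ω → ℝ}
    (hf : ∀ i ∈ I, Measurable (f i)) :
    Measurable fun ω => (({s | ∃ i ∈ I, ω ∈ U i ∧ f i ω = s}.encard : ℕ∞) : ℝ≥0∞) := by
  classical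
  induction I using Finset.induction_on with
  | empty => simp
  | insert i I hi ih =>
    have hU' := fun j hj => hU j (Finset.mem_insert_of_mem hj)
    have hf' := fun j hj => hf j (Finset.mem_insert_of_mem hj)
    have hUi := hU i (Finset.mem_insert_self i I)
    have hfi := hf i (Finset.mem_insert_self i I)
    -- The event that index `i` contributes a value not already taken.
    let W : Set Ω := U i \ ⋃ j ∈ I, U j ∩ {ω | f j ω = f i ω}
    have hW : MeasurableSet W := hUi.diff (I.measurableSet_biUnion fun j hj =>
      (hU' j hj).inter (measurableSet_eq_fun (hf' j hj) hfi))
    have heq : (fun ω => (({s | ∃ j ∈ insert i I, ω ∈ U j ∧ f j ω = s}.encard : ℕ∞) : ℝ≥0∞)) =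
        fun ω => (({s | ∃ j ∈ I, ω ∈ U j ∧ f j ω = s}.encard : ℕ∞) : ℝ≥0∞) +
          W.indicator 1 ω := by
      funext ω
      have hins : ω ∈ U i → {s | ∃ j ∈ insert i I, ω ∈ U j ∧ f j ω = s} =
          insert (f i ω) {s | ∃ j ∈ I, ω ∈ U j ∧ f j ω = s} := by
        intro hω
        ext s
        simp only [Finset.exists_mem_insert, Set.mem_ofPred_eq, Set.mem_insert_iff, hω, true_and,
          eq_comm (a := s)]
      by_cases hω : ω ∈ U i
      · rw [hins hω]
        by_cases hmem : f i ω ∈ {s | ∃ j ∈ I, ω ∈ U j ∧ f j ω = s}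
        · have : ω ∉ W := by
            obtain ⟨j, hj, h1, h2⟩ := hmem
            exact fun h => h.2 (Set.mem_iUnion₂.2 ⟨j, hj, h1, h2⟩)
          rw [Set.insert_eq_of_mem hmem, Set.indicator_of_notMem this, add_zero]
        · have : ω ∈ W := by
            refine ⟨hω, fun h => hmem ?_⟩
            obtain ⟨j, hj, h1, h2⟩ := Set.mem_iUnion₂.1 h
            exact ⟨j, hj, h1, h2⟩
          rw [Set.encard_insert_of_notMem hmem, Set.indicator_of_mem this, ENat.toENNReal_add]
          simp
      · have : ω ∉ W := fun h => hω h.1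
        rw [Set.indicator_of_notMem this, add_zero]
        congr 3
        ext s
        simp [hω]
    rw [heq]
    exact (ih hU' hf').add (measurable_one.indicator hW)

/-- Every breakpoint is the crossing parameter of a pair of vertices, so the count is that of the
distinct values of finitely many random variables, each restricted to a measurable event. -/
theorem measurable_encard_breaks {Ω : Type*} [MeasurableSpace Ω]
    (hP : IsCompact (polyhedron a b)) {p q : Ω → EuclideanSpace ℝ (Fin n)} (hp : Measurable p)
    (hq : Measurable q) {R : Set ℝ} (hR : MeasurableSet R) :
    Measurable fun ω =>
      (((breaks (polyhedron a b) (p ω) (q ω) ∩ R).encard : ℕ∞) : ℝ≥0∞) := by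
  classical
  have hV := finite_extremePoints_polyhedron a b
  let f : EuclideanSpace ℝ (Fin n) × EuclideanSpace ℝ (Fin n) → Ω → ℝ := fun z ω =>
    (inner ℝ (p ω) z.1 - inner ℝ (p ω) z.2) / (inner ℝ (q ω) z.2 - inner ℝ (q ω) z.1)
  have hf : ∀ z, Measurable (f z) := fun z => by
    simp only [f]; fun_prop
  have hy : ∀ z, Measurable fun ω => p ω + f z ω • q ω := fun z => hp.add ((hf z).smul hq)
  have hclosed : ∀ x, IsClosed {y | x ∈ maxFace (polyhedron a b) y} := by
    intro x
    by_cases hx : x ∈ polyhedron a b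
    · have : {y | x ∈ maxFace (polyhedron a b) y} =
          ⋂ z ∈ polyhedron a b, {y | inner ℝ y z ≤ inner ℝ y x} := by
        ext y; simp [maxFace, hx]
      rw [this]
      exact isClosed_biInter fun z _ => isClosed_le (by fun_prop) (by fun_prop)
    · have : {y | x ∈ maxFace (polyhedron a b) y} = ∅ := by
        ext y; simp [maxFace, hx]
      rw [this]
      exact isClosed_empty
  let U : EuclideanSpace ℝ (Fin n) × EuclideanSpace ℝ (Fin n) → Set Ω := fun z =>
    (fun ω => p ω + f z ω • q ω) ⁻¹' {y | z.1 ∈ maxFace (polyhedron a b) y} ∩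
      (fun ω => p ω + f z ω • q ω) ⁻¹' {y | z.2 ∈ maxFace (polyhedron a b) y} ∩
      {ω | inner ℝ (q ω) z.1 = inner ℝ (q ω) z.2}ᶜ ∩ f z ⁻¹' R
  have hU : ∀ z, MeasurableSet (U z) := fun z =>
    ((((hclosed z.1).measurableSet.preimage (hy z)).inter
      ((hclosed z.2).measurableSet.preimage (hy z))).inter
      (measurableSet_eq_fun (by fun_prop) (by fun_prop)).compl).inter
      (hR.preimage (hf z))
  have heq : ∀ ω, breaks (polyhedron a b) (p ω) (q ω) ∩ R =
      {s | ∃ z ∈ hV.toFinset ×ˢ hV.toFinset, ω ∈ U z ∧ f z ω = s} := by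
    intro ω
    ext s
    constructor
    · rintro ⟨hs, hs0⟩
      obtain ⟨x, hx, x', hx', h1, h2, h3⟩ := (mem_breaks_iff hP).1 hs
      have hfs : f (x, x') ω = s := (eq_div_of_mem_maxFace h1 h2 h3).symm
      refine ⟨(x, x'), by simp [hx, hx'], ⟨⟨⟨?_, ?_⟩, h3⟩, ?_⟩, hfs⟩
      · change x ∈ maxFace _ (p ω + f (x, x') ω • q ω)
        rw [hfs]; exact h1
      · change x' ∈ maxFace _ (p ω + f (x, x') ω • q ω)
        rw [hfs]; exact h2
      · change f (x, x') ω ∈ R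
        rw [hfs]; exact hs0
    · rintro ⟨z, -, ⟨⟨⟨h1, h2⟩, h3⟩, h4⟩, rfl⟩
      exact ⟨⟨z.1, h1, z.2, h2, h3⟩, h4⟩
  simp only [heq]
  exact measurable_encard_setOf _ (fun z _ => hU z) fun z _ => hf z

end Breaks

/-! ### Edges of the lower envelope of a planar convex set. -/

section Plane

variable {Q : Set (ℝ × ℝ)} {s : ℝ}

/-- The face of `Q` on the supporting line of slope `s` from below. -/
def lowerFace (Q : Set (ℝ × ℝ)) (s : ℝ) : Set (ℝ × ℝ) :=
  {z ∈ Q | ∀ z' ∈ Q, z.2 - s * z.1 ≤ z'.2 - s * z'.1}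

theorem isExposed_lowerFace (Q : Set (ℝ × ℝ)) (s : ℝ) : IsExposed ℝ Q (lowerFace Q s) := by
  refine fun _ => ⟨s • ContinuousLinearMap.fst ℝ ℝ ℝ - ContinuousLinearMap.snd ℝ ℝ ℝ, ?_⟩
  ext z
  refine and_congr_right fun _ => forall₂_congr fun z' _ => ?_
  simp only [_root_.sub_apply, _root_.smul_apply,
    ContinuousLinearMap.coe_fst', ContinuousLinearMap.coe_snd', smul_eq_mul]
  constructor <;> intro h <;> linarith

theorem eq_of_mem_lowerFace {z z' : ℝ × ℝ} (hz : z ∈ lowerFace Q s) (hz' : z' ∈ lowerFace Q s) :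
    z.2 - s * z.1 = z'.2 - s * z'.1 :=
  le_antisymm (hz.2 z' hz'.1) (hz'.2 z hz.1)

theorem lowerFace_subset_lowerEnvelope (Q : Set (ℝ × ℝ)) (s : ℝ) :
    lowerFace Q s ⊆ lowerEnvelope Q := by
  refine fun z hz => ⟨hz.1, fun z' hz' h => ?_⟩
  have := hz.2 z' hz'
  rw [h] at this
  linarith

theorem lowerFace_slope_unique {s' : ℝ} {p q : ℝ × ℝ} (hp : p ∈ lowerFace Q s)
    (hq : q ∈ lowerFace Q s) (hne : p.1 ≠ q.1) (h : lowerFace Q s = lowerFace Q s') : s = s' := by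
  have h1 := eq_of_mem_lowerFace hp hq
  have h2 := eq_of_mem_lowerFace (h ▸ hp) (h ▸ hq)
  have h3 : (s - s') * (p.1 - q.1) = 0 := by linarith
  rcases mul_eq_zero.1 h3 with h | h
  · exact sub_eq_zero.1 h
  · exact absurd (sub_eq_zero.1 h) hne

theorem eq_add_smul_of_collinear {p q z : ℝ × ℝ} (h1 : p.2 - s * p.1 = z.2 - s * z.1)
    (h2 : q.2 - s * q.1 = z.2 - s * z.1) (hpq : p.1 ≠ q.1) :
    (1 - (z.1 - p.1) / (q.1 - p.1)) • p + ((z.1 - p.1) / (q.1 - p.1)) • q = z := by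
  have h : (z.1 - p.1) / (q.1 - p.1) * (q.1 - p.1) = z.1 - p.1 :=
    div_mul_cancel₀ _ (sub_ne_zero.2 hpq.symm)
  generalize (z.1 - p.1) / (q.1 - p.1) = t at h
  ext
  · simp only [Prod.fst_add, Prod.smul_fst, smul_eq_mul]; linarith
  · simp only [Prod.snd_add, Prod.smul_snd, smul_eq_mul]
    linear_combination (1 - t) * h1 + t * h2 + s * h

theorem mem_segment_of_collinear {p q z : ℝ × ℝ} (h1 : p.2 - s * p.1 = z.2 - s * z.1)
    (h2 : q.2 - s * q.1 = z.2 - s * z.1) (hpq : p.1 < q.1) (hpz : p.1 ≤ z.1) (hzq : z.1 ≤ q.1) :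
    z ∈ segment ℝ p q := by
  refine ⟨_, _, ?_, ?_, by ring, eq_add_smul_of_collinear h1 h2 hpq.ne⟩
  · rw [sub_nonneg, div_le_one (sub_pos.2 hpq)]; linarith
  · exact div_nonneg (sub_nonneg.2 hpz) (sub_pos.2 hpq).le

theorem mem_openSegment_of_collinear {p q z : ℝ × ℝ} (h1 : p.2 - s * p.1 = z.2 - s * z.1)
    (h2 : q.2 - s * q.1 = z.2 - s * z.1) (hpz : p.1 < z.1) (hzq : z.1 < q.1) :
    z ∈ openSegment ℝ p q := by
  have hpq := hpz.trans hzq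
  refine ⟨_, _, ?_, ?_, by ring, eq_add_smul_of_collinear h1 h2 hpq.ne⟩
  · rw [sub_pos, div_lt_one (sub_pos.2 hpq)]; linarith
  · exact div_pos (sub_pos.2 hpz) (sub_pos.2 hpq)

theorem isEdge_lowerFace (hQ : IsCompact Q) (hconv : Convex ℝ Q) {p q : ℝ × ℝ}
    (hp : p ∈ lowerFace Q s) (hq : q ∈ lowerFace Q s) (hne : p.1 ≠ q.1) :
    IsEdge Q (lowerFace Q s) := by
  have hM := (isExposed_lowerFace Q s).isCompact hQ
  refine ⟨?_, (isExposed_lowerFace Q s).isExtreme⟩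
  obtain ⟨p', hp', hmin⟩ := hM.exists_isMinOn ⟨p, hp⟩ continuous_fst.continuousOn
  obtain ⟨q', hq', hmax⟩ := hM.exists_isMaxOn ⟨p, hp⟩ continuous_fst.continuousOn
  have hlt : p'.1 < q'.1 := by
    have h1 : p'.1 ≤ p.1 := hmin hp
    have h2 : p'.1 ≤ q.1 := hmin hq
    have h3 : p.1 ≤ q'.1 := hmax hp
    have h4 : q.1 ≤ q'.1 := hmax hq
    rcases hne.lt_or_gt with h | h <;> linarith
  refine ⟨p', q', fun h => hlt.ne (by rw [h]), Set.Subset.antisymm (fun z hz => ?_) ?_⟩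
  · exact mem_segment_of_collinear (eq_of_mem_lowerFace hp' hz) (eq_of_mem_lowerFace hq' hz) hlt
      (hmin hz) (hmax hz)
  · exact ((isExposed_lowerFace Q s).convex hconv).segment_subset hp' hq'

/-- The segment from `p` to `z` passes over the envelope point `r`; as `p` and `r` lie on one line
of slope `s`, its far end `z` cannot be below that line. -/
theorem le_of_mem_lowerEnvelope (hconv : Convex ℝ Q) {p r z : ℝ × ℝ} (hp : p ∈ Q)
    (hr : r ∈ lowerEnvelope Q) (hz : z ∈ Q) (hpr : p.2 - s * p.1 = r.2 - s * r.1) {t : ℝ}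
    (ht0 : 0 < t) (ht1 : t ≤ 1) (ht : (1 - t) * p.1 + t * z.1 = r.1) :
    r.2 - s * r.1 ≤ z.2 - s * z.1 := by
  have h := hr.2 _ (hconv hp hz (sub_nonneg.2 ht1) ht0.le (by ring))
    (by simpa only [Prod.fst_add, Prod.smul_fst, smul_eq_mul] using ht)
  simp only [Prod.snd_add, Prod.smul_snd, smul_eq_mul] at h
  have : t * (r.2 - s * r.1) ≤ t * (z.2 - s * z.1) := by
    linear_combination h + (1 - t) * hpr + s * ht
  exact le_of_mul_le_mul_left this ht0

/-- A nondegenerate segment that is an extreme set and lies on the lower envelope is cut out by a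
nonvertical supporting line. -/
theorem exists_eq_lowerFace (hconv : Convex ℝ Q) {e : Set (ℝ × ℝ)} (he : IsEdge Q e)
    (hlow : e ⊆ lowerEnvelope Q) :
    ∃ s, e = lowerFace Q s ∧ ∃ p ∈ e, ∃ q ∈ e, p.1 ≠ q.1 := by
  obtain ⟨⟨p, q, hpq, hlt, rfl⟩, hext⟩ : (∃ p q : ℝ × ℝ, p ≠ q ∧ p.1 < q.1 ∧ e = segment ℝ p q) ∧
      IsExtreme ℝ Q e := by
    refine ⟨?_, he.2⟩
    obtain ⟨⟨p, q, hpq, rfl⟩, -⟩ := he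
    rcases lt_trichotomy p.1 q.1 with h | h | h
    · exact ⟨p, q, hpq, h, rfl⟩
    · have hp := hlow (left_mem_segment ℝ p q)
      have hq := hlow (right_mem_segment ℝ p q)
      exact absurd (Prod.ext h (le_antisymm (hp.2 q hq.1 h.symm) (hq.2 p hp.1 h))) hpq
    · exact ⟨q, p, hpq.symm, h, segment_symm ℝ p q⟩
  have hpe := left_mem_segment ℝ p q
  have hqe := right_mem_segment ℝ p q
  obtain ⟨s, hs⟩ : ∃ s, p.2 - s * p.1 = q.2 - s * q.1 := by
    refine ⟨(q.2 - p.2) / (q.1 - p.1), ?_⟩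
    have : (q.2 - p.2) / (q.1 - p.1) * (q.1 - p.1) = q.2 - p.2 :=
      div_mul_cancel₀ _ (sub_pos.2 hlt).ne'
    linarith
  have hseg : ∀ z ∈ segment ℝ p q, z.2 - s * z.1 = p.2 - s * p.1 := by
    rintro z ⟨α, β, -, -, hαβ, rfl⟩
    simp only [Prod.fst_add, Prod.snd_add, Prod.smul_fst, Prod.smul_snd, smul_eq_mul]
    linear_combination (p.2 - s * p.1) * hαβ - β * hs
  -- The midpoint is strictly between the ends, so any `z` in `Q` is joined across it to `p` or to
  -- `q`, whichever is on the other side.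
  have hr : (1 / 2 : ℝ) • p + (1 / 2 : ℝ) • q ∈ segment ℝ p q :=
    ⟨1 / 2, 1 / 2, by norm_num, by norm_num, by norm_num, rfl⟩
  have hr1 : ((1 / 2 : ℝ) • p + (1 / 2 : ℝ) • q).1 = (p.1 + q.1) / 2 := by
    simp only [Prod.fst_add, Prod.smul_fst, smul_eq_mul]; ring
  generalize (1 / 2 : ℝ) • p + (1 / 2 : ℝ) • q = r at hr hr1
  have hmin : ∀ z ∈ Q, p.2 - s * p.1 ≤ z.2 - s * z.1 := by
    intro z hz
    rw [← hseg r hr]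
    rcases le_or_gt r.1 z.1 with h | h
    · have hpos : 0 < z.1 - p.1 := by linarith
      refine le_of_mem_lowerEnvelope hconv (hlow hpe).1 (hlow hr) hz (hseg r hr).symm
        (t := (r.1 - p.1) / (z.1 - p.1)) (div_pos (by linarith) hpos)
        ((div_le_one hpos).2 (by linarith)) ?_
      field_simp
      ring
    · have hpos : 0 < q.1 - z.1 := by linarith
      refine le_of_mem_lowerEnvelope hconv (hlow hqe).1 (hlow hr) hz
        (hs.symm.trans (hseg r hr).symm)
        (t := (q.1 - r.1) / (q.1 - z.1)) (div_pos (by linarith) hpos)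
        ((div_le_one hpos).2 (by linarith)) ?_
      field_simp
      ring
  refine ⟨s, Set.Subset.antisymm (fun z hz => ⟨(hlow hz).1, fun z' hz' => ?_⟩) (fun z hz => ?_),
    p, hpe, q, hqe, hlt.ne⟩
  · rw [hseg z hz]; exact hmin z' hz'
  · have hzp : z.2 - s * z.1 = p.2 - s * p.1 :=
      le_antisymm (hz.2 p (hlow hpe).1) (hmin z hz.1)
    -- A point of the supporting line beyond an endpoint would have that endpoint in an open
    -- segment, so extremality puts it back into the edge.
    rcases lt_or_ge z.1 p.1 with h | h
    · exact hext.left_mem_of_mem_openSegment hz.1 (hlow hqe).1 hpe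
        (mem_openSegment_of_collinear hzp hs.symm h hlt)
    rcases lt_or_ge q.1 z.1 with h' | h'
    · exact hext.right_mem_of_mem_openSegment (hlow hpe).1 hz.1 hqe
        (mem_openSegment_of_collinear hs (hzp.trans hs) hlt h')
    · exact mem_segment_of_collinear hzp.symm (hs.symm.trans hzp.symm) hlt h h'

end Plane

/-! ### From path edges to breakpoints. -/

section Path

variable {n : ℕ} {P : Set (EuclideanSpace ℝ (Fin n))} {c w x₀ : EuclideanSpace ℝ (Fin n)}

theorem proj_image_maxFace (P : Set (EuclideanSpace ℝ (Fin n)))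
    (c w : EuclideanSpace ℝ (Fin n)) (s : ℝ) :
    proj c w '' maxFace P (-w + s • c) = lowerFace (shadow P c w) s := by
  have key : ∀ x, inner ℝ (-w + s • c) x = -((proj c w x).2 - s * (proj c w x).1) := by
    intro x
    rw [inner_add_left, inner_neg_left, real_inner_smul_left, proj]
    ring
  ext z
  constructor
  · rintro ⟨x, ⟨hx, hmax⟩, rfl⟩
    refine ⟨⟨x, hx, rfl⟩, ?_⟩
    rintro _ ⟨x', hx', rfl⟩
    have := hmax x' hx'
    rw [key, key] at this
    linarith
  · rintro ⟨⟨x, hx, rfl⟩, hmin⟩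
    refine ⟨x, ⟨hx, fun x' hx' => ?_⟩, rfl⟩
    have := hmin _ ⟨x', hx', rfl⟩
    rw [key, key]
    linarith

theorem mem_breaks_iff_lowerFace {s : ℝ} : s ∈ breaks P (-w) c ↔
    ∃ p ∈ lowerFace (shadow P c w) s, ∃ q ∈ lowerFace (shadow P c w) s, p.1 ≠ q.1 := by
  rw [← proj_image_maxFace]
  simp only [Set.exists_mem_image]
  rfl

theorem isCompact_shadow (hP : IsCompact P) : IsCompact (shadow P c w) :=
  hP.image (by unfold proj; fun_prop)

theorem convex_shadow (hP : Convex ℝ P) : Convex ℝ (shadow P c w) := by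
  have : IsLinearMap ℝ (proj c w) :=
    ⟨fun x y => by simp [proj, inner_add_right], fun r x => by simp [proj, real_inner_smul_right]⟩
  exact hP.is_linear_image this

/-- The edges of the path correspond to the breakpoints of `s ↦ max_{x ∈ P} ⟪s c - w, x⟫`. -/
theorem encard_pathEdges (hP : IsCompact P) (hconv : Convex ℝ P) (hx₀ : x₀ ∈ P)
    (hmin : ∀ x ∈ P, inner ℝ w x₀ ≤ inner ℝ w x)
    (huniq : ∀ x ∈ P, inner ℝ w x ≤ inner ℝ w x₀ → x = x₀) :
    (pathEdges P x₀ c w).encard = (breaks P (-w) c ∩ Set.Ioi 0).encard := by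
  have himage : pathEdges P x₀ c w = lowerFace (shadow P c w) '' (breaks P (-w) c ∩ Set.Ioi 0) := by
    ext e
    constructor
    · rintro ⟨hedge, hpath⟩
      obtain ⟨s, rfl, p, hp, q, hq, hne⟩ := exists_eq_lowerFace (convex_shadow hconv) hedge
        (hpath.trans fun z hz => hz.1)
      refine ⟨s, ⟨mem_breaks_iff_lowerFace.2 ⟨p, hp, q, hq, hne⟩, ?_⟩, rfl⟩
      by_contra hs
      have hs : s ≤ 0 := not_lt.1 hs
      -- For `s ≤ 0`, a point of the face to the right of `π(x₀)` is no higher than `π(x₀)`, so by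
      -- uniqueness of the minimizer the edge collapses to a point.
      have key : ∀ z ∈ lowerFace (shadow P c w) s, z = proj c w x₀ := by
        rintro z hz
        have h1 := hz.2 _ ⟨x₀, hx₀, rfl⟩
        have h2 := (hpath hz).2
        obtain ⟨x, hx, rfl⟩ := hz.1
        have h3 := mul_nonneg (neg_nonneg.2 hs) (sub_nonneg.2 h2)
        rw [huniq x hx]
        change (proj c w x).2 ≤ (proj c w x₀).2
        linarith
      exact hne (by rw [key p hp, key q hq])
    · rintro ⟨s, ⟨hs, hs0⟩, rfl⟩
      have hs0 : 0 < s := hs0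
      obtain ⟨p, hp, q, hq, hne⟩ := mem_breaks_iff_lowerFace.1 hs
      refine ⟨isEdge_lowerFace (isCompact_shadow hP) (convex_shadow hconv) hp hq hne,
        fun z hz => ⟨lowerFace_subset_lowerEnvelope _ _ hz, ?_⟩⟩
      have h1 := hz.2 _ ⟨x₀, hx₀, rfl⟩
      obtain ⟨x, hx, rfl⟩ := hz.1
      have h2 : (proj c w x₀).2 ≤ (proj c w x).2 := hmin x hx
      have h3 : s * (proj c w x₀).1 ≤ s * (proj c w x).1 := by linarith
      exact le_of_mul_le_mul_left h3 hs0
  rw [himage, Set.InjOn.encard_image]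
  rintro s ⟨hs, -⟩ s' - h
  obtain ⟨p, hp, q, hq, hne⟩ := mem_breaks_iff_lowerFace.1 hs
  exact lowerFace_slope_unique hp hq hne h

end Path

/-! ### The starting vertex, and norm bounds for the two objectives. -/

section Start

variable {n m : ℕ} {a : Fin m → EuclideanSpace ℝ (Fin n)} {b : Fin m → ℝ}

/-- The difference of objective values is the sum of the slacks of the starting rows weighted by the
positive `lam k`; if it vanishes, all `n` independent rows are tight at `x`. -/
theorem startObjective_min {x₀ : EuclideanSpace ℝ (Fin n)} {B : Fin n → Fin m}
    (hB : LinearIndependent ℝ fun k => a (B k)) (htight : ∀ k, inner ℝ (a (B k)) x₀ = b (B k))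
    {lam : Fin n → ℝ} (hlam : ∀ k, 0 < lam k) {x : EuclideanSpace ℝ (Fin n)}
    (hx : x ∈ polyhedron a b) :
    inner ℝ (startObjective (fun k => a (B k)) lam) x₀ ≤
        inner ℝ (startObjective (fun k => a (B k)) lam) x ∧
      (inner ℝ (startObjective (fun k => a (B k)) lam) x ≤
        inner ℝ (startObjective (fun k => a (B k)) lam) x₀ → x = x₀) := by
  have hkey : inner ℝ (startObjective (fun k => a (B k)) lam) x -
      inner ℝ (startObjective (fun k => a (B k)) lam) x₀ =
      ∑ k, lam k * (b (B k) - inner ℝ (a (B k)) x) := by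
    simp only [startObjective, inner_neg_left, sum_inner, real_inner_smul_left, htight, mul_sub,
      Finset.sum_sub_distrib]
    ring
  have hnn : ∀ k ∈ Finset.univ, 0 ≤ lam k * (b (B k) - inner ℝ (a (B k)) x) := fun k _ =>
    mul_nonneg (hlam k).le (sub_nonneg.2 (hx (B k)))
  have hsum := Finset.sum_nonneg hnn
  refine ⟨by linarith, fun h => ?_⟩
  have h0 := (Finset.sum_eq_zero_iff_of_nonneg hnn).1 (le_antisymm (by linarith) hsum)
  have horth : ∀ k, inner ℝ (a (B k)) (x - x₀) = 0 := by
    intro k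
    have h1 := (mul_eq_zero.1 (h0 k (Finset.mem_univ k))).resolve_left (hlam k).ne'
    rw [inner_sub_right, htight]
    linarith
  have hspan : Submodule.span ℝ (Set.range fun k => a (B k)) = ⊤ :=
    hB.span_eq_top_of_card_eq_finrank' (by simp)
  refine sub_eq_zero.1 (eq_zero_of_span_eq_top hspan ?_)
  rintro _ ⟨k, rfl⟩
  exact horth k

/-- The coefficients of a row in a basis of rows are bounded by `1 / δ`. -/
theorem exists_sum_smul_eq_row {δ : ℝ} (hδ : 0 < δ) (hdist : DeltaDistanceProperty a δ)
    (ha : ∀ i, ‖a i‖ = 1) {B : Fin n → Fin m} (hB : LinearIndependent ℝ fun k => a (B k))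
    (k : Fin m) : ∃ α : Fin n → ℝ, ∑ j, α j • a (B j) = a k ∧ ∑ j, |α j| ≤ n / δ := by
  have hspan : Submodule.span ℝ (Set.range fun k => a (B k)) = ⊤ :=
    hB.span_eq_top_of_card_eq_finrank' (by simp)
  obtain ⟨α, hα⟩ : ∃ α : Fin n → ℝ, ∑ j, α j • a (B j) = a k := by
    have : a k ∈ Submodule.span ℝ (Set.range fun k => a (B k)) := hspan ▸ Submodule.mem_top
    exact (Submodule.mem_span_range_iff_exists_fun ℝ).1 this
  refine ⟨α, hα, ?_⟩
  have hle : ∀ j, |α j| ≤ 1 / δ := by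
    intro j
    rw [le_div_iff₀ hδ, ← ha k]
    refine hdist.abs_mul_le (I := B '' {i | i ≠ j}) (k := B j)
      (z := ∑ i ∈ Finset.univ.erase j, α i • a (B i)) ?_ ?_ ?_
    · rw [Set.image_image]
      exact hB.notMem_span_image (by simp)
    · exact Submodule.sum_mem _ fun i hi => Submodule.smul_mem _ _ (Submodule.subset_span
        ⟨B i, ⟨i, Finset.ne_of_mem_erase hi, rfl⟩, rfl⟩)
    · rw [← hα, Finset.add_sum_erase _ (fun i => α i • a (B i)) (Finset.mem_univ j)]
  calc ∑ j, |α j| ≤ ∑ _j : Fin n, 1 / δ := Finset.sum_le_sum fun j _ => hle j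
    _ = n / δ := by simp [div_eq_mul_inv]

theorem sum_abs_le_sqrt_mul_norm (x : EuclideanSpace ℝ (Fin n)) :
    ∑ i, |x i| ≤ Real.sqrt n * ‖x‖ := by
  rw [EuclideanSpace.norm_eq, ← Real.sqrt_mul (Nat.cast_nonneg n)]
  refine Real.le_sqrt_of_sq_le ?_
  simpa using sq_sum_le_card_mul_sum_sq (s := Finset.univ) (f := fun i => |x i|)

theorem norm_sum_smul_le {u : Fin n → EuclideanSpace ℝ (Fin n)} (hu : ∀ k, ‖u k‖ = 1)
    {lam : Fin n → ℝ} (hlam : ∀ k, lam k ∈ Set.Ioc (0 : ℝ) 1) : ‖∑ k, lam k • u k‖ ≤ n := by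
  calc ‖∑ k, lam k • u k‖ ≤ ∑ _k : Fin n, (1 : ℝ) := by
        refine norm_sum_le_of_le _ fun k _ => ?_
        rw [norm_smul, hu, mul_one, Real.norm_eq_abs, abs_of_pos (hlam k).1]
        exact (hlam k).2
    _ = n := by simp

/-- Each coordinate is within `1 / φ` of that of `c₀`, so the distance is at most `√n / φ ≤ 1`; this
is where `φ ≥ √n` enters. -/
theorem norm_toLp_le_two {φ : ℝ} (hφ0 : 0 < φ) (hφ : Real.sqrt n ≤ φ)
    {c₀ : EuclideanSpace ℝ (Fin n)} (hc₀ : ‖c₀‖ = 1) {l : Fin n → ℝ}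
    (hlc : ∀ i, c₀ i ∈ Set.Icc (l i) (l i + 1 / φ)) {c : Fin n → ℝ}
    (hc : ∀ i, c i ∈ Set.Icc (l i) (l i + 1 / φ)) : ‖WithLp.toLp 2 c‖ ≤ 2 := by
  have h1 : ‖WithLp.toLp 2 c - c₀‖ ≤ 1 := by
    rw [EuclideanSpace.norm_eq]
    refine (Real.sqrt_le_sqrt ?_).trans_eq Real.sqrt_one
    calc ∑ i, ‖(WithLp.toLp 2 c - c₀) i‖ ^ 2 ≤ ∑ _i : Fin n, (1 / φ) ^ 2 := by
          refine Finset.sum_le_sum fun i _ => ?_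
          refine pow_le_pow_left₀ (norm_nonneg _) ?_ 2
          rw [Real.norm_eq_abs, PiLp.sub_apply, abs_le]
          have h1 := hc i
          have h2 := hlc i
          constructor
          · change -(1 / φ) ≤ c i - c₀ i
            linarith [h1.1, h2.2]
          · change c i - c₀ i ≤ 1 / φ
            linarith [h1.2, h2.1]
      _ = n / φ ^ 2 := by simp [div_eq_mul_inv]
      _ ≤ 1 := by
          rw [div_le_one (by positivity)]
          exact (Real.sqrt_le_left hφ0.le).1 hφ
  calc ‖WithLp.toLp 2 c‖ = ‖(WithLp.toLp 2 c - c₀) + c₀‖ := by rw [sub_add_cancel]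
    _ ≤ ‖WithLp.toLp 2 c - c₀‖ + ‖c₀‖ := norm_add_le _ _
    _ ≤ 2 := by rw [hc₀]; linarith

end Start

/-! ### Product laws, and bounds obtained by freezing one of the two draws. -/

section Laws

variable {n : ℕ}

theorem isProbabilityMeasure_pi_cond {S : Fin n → Set ℝ} {w : ℝ} (hw : 0 < w)
    (hvol : ∀ i, volume (S i) = ENNReal.ofReal w) :
    IsProbabilityMeasure (Measure.pi fun i => (volume : Measure ℝ)[|S i]) := by
  have : ∀ i, IsProbabilityMeasure ((volume : Measure ℝ)[|S i]) := fun i =>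
    cond_isProbabilityMeasure_of_finite (by rw [hvol]; simpa using hw)
      (by rw [hvol]; exact ENNReal.ofReal_ne_top)
  infer_instance

theorem ae_pi_cond_mem {S : Fin n → Set ℝ} {w : ℝ} (hw : 0 < w)
    (hS : ∀ i, MeasurableSet (S i)) (hvol : ∀ i, volume (S i) = ENNReal.ofReal w) :
    ∀ᵐ x ∂(Measure.pi fun i => (volume : Measure ℝ)[|S i]), ∀ i, x i ∈ S i := by
  have : ∀ i, IsProbabilityMeasure ((volume : Measure ℝ)[|S i]) := fun i =>
    cond_isProbabilityMeasure_of_finite (by rw [hvol]; simpa using hw)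
      (by rw [hvol]; exact ENNReal.ofReal_ne_top)
  refine ae_all_iff.2 fun i => ?_
  exact (Measure.tendsto_eval_ae_ae (μ := fun i => (volume : Measure ℝ)[|S i])).eventually
    (ae_cond_mem (hS i))

theorem prod_apply_le_of_right {α β : Type*} [MeasurableSpace α] [MeasurableSpace β]
    {μ : Measure α} {ν : Measure β} [IsProbabilityMeasure μ] [SFinite ν] {Z : Set (α × β)}
    (hZ : MeasurableSet Z) {K : ℝ≥0∞} (h : ∀ x, ν (Prod.mk x ⁻¹' Z) ≤ K) : μ.prod ν Z ≤ K := by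
  rw [Measure.prod_apply hZ]
  exact (lintegral_mono h).trans (by simp)

theorem prod_apply_le_of_left {α β : Type*} [MeasurableSpace α] [MeasurableSpace β]
    {μ : Measure α} {ν : Measure β} [SFinite μ] [IsProbabilityMeasure ν] {Z : Set (α × β)}
    (hZ : MeasurableSet Z) {K : ℝ≥0∞} (h : ∀ y, μ ((fun x => (x, y)) ⁻¹' Z) ≤ K) :
    μ.prod ν Z ≤ K := by
  rw [Measure.prod_apply_symm hZ]
  exact (lintegral_mono h).trans (by simp)

end Laws

end ShadowVertex

/-! ### Assembly of the two halves. -/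

open ShadowVertex

theorem theorem3 (n m : ℕ) (a : Fin m → EuclideanSpace ℝ (Fin n)) (b : Fin m → ℝ)
    (c₀ x₀ : EuclideanSpace ℝ (Fin n)) (δ φ : ℝ)
    (ha : ∀ i, ‖a i‖ = 1) (hc₀ : ‖c₀‖ = 1)
    (hbdd : Bornology.IsBounded (ShadowVertex.polyhedron a b))
    (hnondeg : ShadowVertex.Nondegenerate a b)
    (hδ : 0 < δ) (hdist : ShadowVertex.DeltaDistanceProperty a δ)
    (hφ : Real.sqrt n ≤ φ)
    -- the perturbation intervals `[l i, l i + 1 / φ] ⊆ [-1, 1]` contain the coordinates of `c₀`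
    (l : Fin n → ℝ) (hl : ∀ i, -1 ≤ l i ∧ l i + 1 / φ ≤ 1)
    (hlc : ∀ i, c₀ i ∈ Set.Icc (l i) (l i + 1 / φ))
    -- `x₀` is a basic feasible solution with the `n` linearly independent tight rows `a (B k)`
    (hx₀ : x₀ ∈ ShadowVertex.polyhedron a b)
    (B : Fin n → Fin m) (hB : LinearIndependent ℝ fun k => a (B k))
    (htight : ∀ k, inner ℝ (a (B k)) x₀ = b (B k)) :
    AEMeasurable
        (ShadowVertex.numPathEdges (ShadowVertex.polyhedron a b) x₀ fun k => a (B k))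
        ((ShadowVertex.perturbationLaw l φ).prod (ShadowVertex.coefficientLaw n)) ∧
      ∫⁻ ω, ShadowVertex.numPathEdges (ShadowVertex.polyhedron a b) x₀ (fun k => a (B k)) ω
          ∂((ShadowVertex.perturbationLaw l φ).prod (ShadowVertex.coefficientLaw n)) ≤
        ENNReal.ofReal (4 * m * n ^ 2 / δ ^ 2 + 2 * m * Real.sqrt n * φ / δ) := by
  have hn : 0 < n := by
    rcases Nat.eq_zero_or_pos n with rfl | h
    · rw [Subsingleton.elim c₀ 0, norm_zero] at hc₀
      exact absurd hc₀ zero_ne_one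
    · exact h
  have hn0 : (0 : ℝ) < n := by exact_mod_cast hn
  have hφ0 : 0 < φ := (Real.sqrt_pos.2 hn0).trans_le hφ
  have hφ1 : 0 < 1 / φ := by positivity
  have hP := isCompact_polyhedron hbdd
  have hSc : ∀ i, MeasurableSet (Set.Icc (l i) (l i + 1 / φ)) := fun i => measurableSet_Icc
  have hvc : ∀ i, volume (Set.Icc (l i) (l i + 1 / φ)) = ENNReal.ofReal (1 / φ) := fun i => by
    rw [Real.volume_Icc, add_sub_cancel_left]
  have hsc : ∀ i t, volume {x | x - t ∈ Set.Icc (l i) (l i + 1 / φ) ∧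
      x ∉ Set.Icc (l i) (l i + 1 / φ)} ≤ ENNReal.ofReal |t| :=
    fun i t => volume_shift_sdiff_Icc_le _ _ t
  have hSl : ∀ _ : Fin n, MeasurableSet (Set.Ioc (0 : ℝ) 1) := fun _ => measurableSet_Ioc
  have hvl : ∀ _ : Fin n, volume (Set.Ioc (0 : ℝ) 1) = ENNReal.ofReal 1 := fun _ => by simp
  have hsl : ∀ (_ : Fin n) (t : ℝ), volume {x | x - t ∈ Set.Ioc (0 : ℝ) 1 ∧
      x ∉ Set.Ioc (0 : ℝ) 1} ≤ ENNReal.ofReal |t| := fun _ t => by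
    simpa using volume_shift_sdiff_Ioc_le 0 1 t
  have hprobc : IsProbabilityMeasure (perturbationLaw l φ) := isProbabilityMeasure_pi_cond hφ1 hvc
  have hprobl : IsProbabilityMeasure (coefficientLaw n) :=
    isProbabilityMeasure_pi_cond one_pos hvl
  have haec : ∀ᵐ ω ∂(perturbationLaw l φ).prod (coefficientLaw n),
      ∀ i, ω.1 i ∈ Set.Icc (l i) (l i + 1 / φ) :=
    Measure.quasiMeasurePreserving_fst.ae (ae_pi_cond_mem hφ1 hSc hvc)
  have hael : ∀ᵐ ω ∂(perturbationLaw l φ).prod (coefficientLaw n),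
      ∀ i, ω.2 i ∈ Set.Ioc (0 : ℝ) 1 :=
    Measure.quasiMeasurePreserving_snd.ae (ae_pi_cond_mem one_pos hSl hvl)
  let c : (Fin n → ℝ) → EuclideanSpace ℝ (Fin n) := fun x => WithLp.toLp 2 x
  let v : (Fin n → ℝ) → EuclideanSpace ℝ (Fin n) := fun x => ∑ k, x k • a (B k)
  have hc : Measurable c := (PiLp.continuous_toLp 2 _).measurable
  have hv : Measurable v := by
    refine Continuous.measurable ?_
    fun_prop
  have hc1 : Measurable fun ω : (Fin n → ℝ) × (Fin n → ℝ) => c ω.1 := hc.comp measurable_fst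
  have hv2 : Measurable fun ω : (Fin n → ℝ) × (Fin n → ℝ) => v ω.2 := hv.comp measurable_snd
  have hnum : numPathEdges (polyhedron a b) x₀ (fun k => a (B k))
      =ᵐ[(perturbationLaw l φ).prod (coefficientLaw n)] fun ω =>
        (((breaks (polyhedron a b) (v ω.2) (c ω.1) ∩ Set.Ioi 0).encard : ℕ∞) : ℝ≥0∞) := by
    filter_upwards [hael] with ω hω
    have hmin := fun x (hx : x ∈ polyhedron a b) =>
      startObjective_min hB htight (fun k => (hω k).1) hx
    rw [numPathEdges, encard_pathEdges hP (convex_polyhedron a b) hx₀ (fun x hx => (hmin x hx).1)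
      fun x hx => (hmin x hx).2]
    simp only [startObjective, neg_neg, c, v]
  refine ⟨(measurable_encard_breaks hP hv2 hc1 measurableSet_Ioi).aemeasurable.congr hnum.symm, ?_⟩
  rw [lintegral_congr_ae hnum]
  -- With `c` frozen, `λ` ranges over a unit box and `a k` is expanded in the starting rows. Here `L
  -- = 2 / δ` since `‖c‖ ≤ 2`, giving `2 * m * (2 / δ) * n * (n / δ)`.
  have hfirst := lintegral_encard_breaks_le ((perturbationLaw l φ).prod (coefficientLaw n)) hP
    hnondeg hδ hdist hv2 hc1 (L := 2 / δ) (T := n) (D := n / δ) (by positivity) hn0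
    (by
      filter_upwards [haec] with ω hω
      rw [div_mul_cancel₀ _ hδ.ne']
      exact norm_toLp_le_two hφ0 hφ hc₀ hlc hω)
    (by
      intro k t η _ hη
      obtain ⟨α, hα, hαn⟩ := exists_sum_smul_eq_row hδ hdist ha hB k
      refine prod_apply_le_of_right ((measurableSet_wallSet hnondeg k measurableSet_Ioo).preimage
        (hv2.add (hc1.const_smul t))) fun x => ?_
      refine (pi_cond_wallSet_le one_pos hSl hvl hsl hnondeg (k := k)
        (Y := fun y => v y + t • c x) (hv.add measurable_const) (α := α) ?_ hη).trans ?_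
      · intro y r
        simp only [v, Pi.add_apply, Pi.smul_apply, smul_eq_mul, add_smul, Finset.sum_add_distrib,
          mul_smul, ← Finset.smul_sum, hα]
        abel
      · rw [div_one]
        exact ENNReal.ofReal_le_ofReal (by gcongr))
  -- With `λ` frozen, `c` ranges over a box of side `1 / φ` and is shifted along `a k` itself, whose
  -- `ℓ¹` norm is at most `√n`. Here `L = n / δ` since `‖v‖ ≤ n`, and `T = 1 / n` cancels that `n`.
  have hsecond := lintegral_encard_breaks_le ((perturbationLaw l φ).prod (coefficientLaw n)) hP
    hnondeg hδ hdist hc1 hv2 (L := n / δ) (T := (n : ℝ)⁻¹) (D := Real.sqrt n * φ) (by positivity)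
    (by positivity)
    (by
      filter_upwards [hael] with ω hω
      rw [div_mul_cancel₀ _ hδ.ne']
      exact norm_sum_smul_le (fun k => ha (B k)) hω)
    (by
      intro k t η _ hη
      refine prod_apply_le_of_left ((measurableSet_wallSet hnondeg k measurableSet_Ioo).preimage
        (hc1.add (hv2.const_smul t))) fun y => ?_
      refine (pi_cond_wallSet_le hφ1 hSc hvc hsc hnondeg (k := k)
        (Y := fun x => c x + t • v y) (hc.add measurable_const) (α := fun i => a k i)
        ?_ hη).trans ?_
      · intro x r
        ext i
        simp [c]
        ring
      · rw [div_div_eq_mul_div, div_one]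
        refine ENNReal.ofReal_le_ofReal ?_
        have := sum_abs_le_sqrt_mul_norm (a k)
        rw [ha k, mul_one] at this
        gcongr)
  calc ∫⁻ ω, (((breaks (polyhedron a b) (v ω.2) (c ω.1) ∩ Set.Ioi 0).encard : ℕ∞) : ℝ≥0∞)
        ∂(perturbationLaw l φ).prod (coefficientLaw n)
      ≤ ∫⁻ ω, ((((breaks (polyhedron a b) (v ω.2) (c ω.1) ∩ Set.Ioc 0 n).encard : ℕ∞) : ℝ≥0∞) +
          (((breaks (polyhedron a b) (c ω.1) (v ω.2) ∩ Set.Ioc 0 (n : ℝ)⁻¹).encard : ℕ∞) : ℝ≥0∞))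
          ∂(perturbationLaw l φ).prod (coefficientLaw n) := by
        refine lintegral_mono fun ω => ?_
        rw [← ENat.toENNReal_add, ENat.toENNReal_le]
        exact encard_breaks_Ioi_le hn0
    _ = _ := lintegral_add_left (measurable_encard_breaks hP hv2 hc1 measurableSet_Ioc) _
    _ ≤ _ := (add_le_add hfirst hsecond)
    _ = _ := by
        rw [← ENNReal.ofReal_add (by positivity) (by positivity)]
        congr 1
        field_simp
        ring
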